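/- Let $\mathbb{Z}_2^n=(\mathbb{Z}/2)^n$ with its standard scalar product $\langle\cdot,\cdot\rangle$, and let $M=(|M|,\mathcal{O}_M)$ be a smooth $\mathbb{Z}_2^n$-manifold: $|M|$ is a second-countable Hausdorff space and $\mathcal{O}_M$ is a sheaf of $\mathbb{Z}_2^n$-graded, $\mathbb{Z}_2^n$-commutative (i.e. $st=(-1)^{\langle\deg s,\deg t\rangle}ts$) unital real algebras with local stalks, locally isomorphic to $(\mathbb{R}^p,C^\infty_{\mathbb{R}^p}(-)[[\xi]])$, where $\xi=(\xi^1,\dots,\xi^N)$ are $\mathbb{Z}_2^n$-commuting formal variables of fixed nonzero degrees. Put $C^\infty(M)=\mathcal{O}_M(|M|)$, and let $\mathrm{Vect}(M)$ be the left $C^\infty(M)$-module of graded derivations of $C^\infty(M)$ (sums of homogeneous ones). Let $g$ be a Riemannian metric on $M$, i.e. a biadditive pairing $\langle\cdot|\cdot\rangle_g:\mathrm{Vect}(M)\times\mathrm{Vect}(M)\to C^\infty(M)$, left $C^\infty(M)$-linear in the first argument, homogeneous of some degree $\deg g\in\mathbb{Z}_2^n$ (so $\deg\langle X|Y\rangle_g=\deg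 X+\deg Y+\deg g$), with $\langle X|Y\rangle_g=(-1)^{\langle\deg X,\deg Y\rangle}\langle Y|X\rangle_g$ for homogeneous $X,Y$, and non-degenerate (in every homogeneous local frame $(E_I)$ the matrix $g_{IJ}=\langle E_I|E_J\rangle_g$ is invertible). Let $\nabla$ be its Levi-Civita connection, i.e. the affine connection with $$\nabla_XY-(-1)^{\langle\deg X,\deg Y\rangle}\nabla_YX=[X,Y],\qquad X\langle Y|Z\rangle_g=\langle\nabla_XY|Z\rangle_g+(-1)^{\langle\deg X,\deg Y\rangle}\langle Y|\nabla_XZ\rangle_g$$ for homogeneous $X,Y,Z$. For homogeneous $f\in C^\infty(M)$ let $\mathrm{grad}_gf$ be the unique vector field such that $X(f)=(-1)^{\langle\deg f,\deg g\rangle}\langle X|\mathrm{grad}_gf\rangle_g$ for all $X\in\mathrm{Vect}(M)$. For a homogeneous vector field $X$ let $\mathrm{Div}_\nabla X$ be the $\mathbb{Z}_2^n$-graded trace of $Z\mapsto\nabla_ZX$; in a local frame $(E_I)$ with $\deg E_I=e_I$ it is $\sum_I(-1)^{\langle e_I,e_I+\deg X\rangle}(\nabla_{E_I}X)^I$, where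 $Z=\sum_IZ^IE_I$. The connection Laplacian is the linear operator on $C^\infty(M)$ given by $\Delta_gf=\mathrm{Div}_\nabla(\mathrm{grad}_gf)$ for homogeneous $f$. If the metric is odd, that is, if the sum of the components of $\deg g$ is $1$ in $\mathbb{Z}/2$, then $\Delta_g$ is the zero map: $\Delta_gf=0$ for all $f\in C^\infty(M)$. -/

import Mathlib

open CategoryTheory TopologicalSpace Opposite
open scoped Manifold ContDiff

universe u

/-! ### The grading group and the sign rule -/

/-- The grading group `ℤ₂ⁿ`. The scalar product of `a` and `b` is `a ⬝ᵥ b : ZMod 2`. -/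
abbrev Z2n (n : ℕ) : Type := Fin n → ZMod 2

/-- The sign `(-1)^z` of a parity `z`. -/
def paritySign (z : ZMod 2) : ℤ := if z = 0 then 1 else -1

theorem paritySign_zero : paritySign 0 = 1 := rfl

theorem paritySign_add (a b : ZMod 2) :
    paritySign (a + b) = paritySign a * paritySign b := by
  revert a b; decide

/-- The commutation factor `(-1)^⟨a, b⟩`. -/
def koszulSign {n : ℕ} (a b : Z2n n) : ℤ := paritySign (a ⬝ᵥ b)

theorem koszulSign_add_left {n : ℕ} (a b c : Z2n n) :
    koszulSign (a + b) c = koszulSign a c * koszulSign b c := by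
  simp [koszulSign, add_dotProduct, paritySign_add]

/-- The total degree of `a` is one. -/
def IsOddDegree {n : ℕ} (a : Z2n n) : Prop := ∑ i, a i = 1

/-! ### The local model: formal power series in `ℤ₂ⁿ`-commuting variables -/

section FormalSeries

variable {n N : ℕ}

/-- The exponents of the monomials that occur: a variable `ξ_A` with `⟨deg ξ_A, deg ξ_A⟩ = 1`
squares to zero, so its exponent is at most one. -/
def IsAdmissible (η : Fin N → Z2n n) (α : Fin N →₀ ℕ) : Prop :=
  ∀ A, η A ⬝ᵥ η A = 1 → α A ≤ 1

/-- The parity `∑_{B < A} ⟨deg ξ_A, deg ξ_B⟩ α_A β_B` picked up when the product of the ordered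
monomials `ξ^α` and `ξ^β` is put in order. -/
def reorderParity (η : Fin N → Z2n n) (α β : Fin N →₀ ℕ) : ZMod 2 :=
  ∑ A, ∑ B, if B < A then (η A ⬝ᵥ η B) * (α A : ZMod 2) * (β B : ZMod 2) else 0

/-- The degree `∑_A α_A deg ξ_A` of the monomial `ξ^α`. -/
def monomialDegree (η : Fin N → Z2n n) (α : Fin N →₀ ℕ) : Z2n n := ∑ A, α A • η A

theorem IsAdmissible.zero (η : Fin N → Z2n n) : IsAdmissible η 0 := fun _ _ => by simp

theorem IsAdmissible.left {η : Fin N → Z2n n} {α β : Fin N →₀ ℕ}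
    (h : IsAdmissible η (α + β)) : IsAdmissible η α := fun A hA => by
  have := h A hA
  simp only [Finsupp.add_apply] at this
  omega

theorem IsAdmissible.right {η : Fin N → Z2n n} {α β : Fin N →₀ ℕ}
    (h : IsAdmissible η (α + β)) : IsAdmissible η β := fun A hA => by
  have := h A hA
  simp only [Finsupp.add_apply] at this
  omega

theorem reorderParity_zero_left (η : Fin N → Z2n n) (α : Fin N →₀ ℕ) :
    reorderParity η 0 α = 0 := by simp [reorderParity]

theorem reorderParity_zero_right (η : Fin N → Z2n n) (α : Fin N →₀ ℕ) :
    reorderParity η α 0 = 0 := by simp [reorderParity]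

theorem reorderParity_add_left (η : Fin N → Z2n n) (α β γ : Fin N →₀ ℕ) :
    reorderParity η (α + β) γ = reorderParity η α γ + reorderParity η β γ := by
  simp only [reorderParity, ← Finset.sum_add_distrib]
  refine Finset.sum_congr rfl fun A _ => Finset.sum_congr rfl fun B _ => ?_
  split_ifs
  · simp only [Finsupp.add_apply, Nat.cast_add]; ring
  · simp

theorem reorderParity_add_right (η : Fin N → Z2n n) (α β γ : Fin N →₀ ℕ) :
    reorderParity η α (β + γ) = reorderParity η α β + reorderParity η α γ := by
  simp only [reorderParity, ← Finset.sum_add_distrib]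
  refine Finset.sum_congr rfl fun A _ => Finset.sum_congr rfl fun B _ => ?_
  split_ifs
  · simp only [Finsupp.add_apply, Nat.cast_add]; ring
  · simp

/-- The coefficient families of the formal series `∑_α f_α ξ^α` over the admissible exponents
(all other coefficients are zero). -/
def formalSeriesSubmodule (R : Type*) [CommRing R] (η : Fin N → Z2n n) :
    Submodule R ((Fin N →₀ ℕ) → R) where
  carrier := {f | ∀ α, ¬ IsAdmissible η α → f α = 0}
  add_mem' hf hg α hα := by simp [hf α hα, hg α hα]
  zero_mem' _ _ := rfl
  smul_mem' c f hf α hα := by simp [hf α hα]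

/-- The algebra `R[[ξ]]` of formal power series, with coefficients in a commutative ring `R`, in
the `ℤ₂ⁿ`-commuting variables `ξ_1, …, ξ_N` of degrees `η 1, …, η N`. -/
def FormalSeries (R : Type*) [CommRing R] (η : Fin N → Z2n n) : Type _ :=
  formalSeriesSubmodule R η

namespace FormalSeries

variable {R : Type*} [CommRing R] {η : Fin N → Z2n n}

instance : AddCommGroup (FormalSeries R η) :=
  inferInstanceAs (AddCommGroup (formalSeriesSubmodule R η))

instance [Algebra ℝ R] : Module ℝ (FormalSeries R η) :=
  inferInstanceAs (Module ℝ (formalSeriesSubmodule R η))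

/-- The coefficient of the ordered monomial `ξ^α`. -/
def coeff (f : FormalSeries R η) (α : Fin N →₀ ℕ) : R := f.1 α

theorem coeff_eq_zero (f : FormalSeries R η) {α : Fin N →₀ ℕ} (h : ¬ IsAdmissible η α) :
    f.coeff α = 0 := f.2 α h

@[ext] theorem ext {f g : FormalSeries R η} (h : ∀ α, IsAdmissible η α → f.coeff α = g.coeff α) :
    f = g := by
  refine Subtype.ext (funext fun α => ?_)
  by_cases hα : IsAdmissible η α
  · exact h α hα
  · exact (f.2 α hα).trans (g.2 α hα).symm

open scoped Classical in
/-- The formal series with given coefficients at the admissible exponents. -/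
noncomputable def mk (c : (Fin N →₀ ℕ) → R) : FormalSeries R η :=
  ⟨fun α => if IsAdmissible η α then c α else 0, fun _ h => if_neg h⟩

theorem coeff_mk (c : (Fin N →₀ ℕ) → R) {α : Fin N →₀ ℕ} (h : IsAdmissible η α) :
    (mk c : FormalSeries R η).coeff α = c α := if_pos h

theorem coeff_add (f g : FormalSeries R η) (α) : (f + g).coeff α = f.coeff α + g.coeff α := rfl

theorem coeff_zero (α) : (0 : FormalSeries R η).coeff α = 0 := rfl

theorem coeff_smul [Algebra ℝ R] (r : ℝ) (f : FormalSeries R η) (α) :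
    (r • f).coeff α = r • f.coeff α := rfl

open scoped Classical in
noncomputable instance : One (FormalSeries R η) := ⟨mk fun α => if α = 0 then 1 else 0⟩

/-- The product determined by `ξ^β ξ^γ = ± ξ^(β+γ)`, with the sign of the reordering. -/
noncomputable instance : Mul (FormalSeries R η) :=
  ⟨fun f g => mk fun α => ∑ x ∈ Finset.HasAntidiagonal.antidiagonal α,
    paritySign (reorderParity η x.1 x.2) • (f.coeff x.1 * g.coeff x.2)⟩

theorem coeff_mul (f g : FormalSeries R η) {α : Fin N →₀ ℕ} (h : IsAdmissible η α) :
    (f * g).coeff α = ∑ x ∈ Finset.HasAntidiagonal.antidiagonal α,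
      paritySign (reorderParity η x.1 x.2) • (f.coeff x.1 * g.coeff x.2) := coeff_mk _ h

open scoped Classical in
theorem coeff_one (α : Fin N →₀ ℕ) :
    (1 : FormalSeries R η).coeff α = if α = 0 then 1 else 0 := by
  by_cases h : IsAdmissible η α
  · exact coeff_mk _ h
  · rw [coeff_eq_zero _ h, if_neg]
    rintro rfl
    exact h (.zero η)

protected theorem mul_assoc (f g h : FormalSeries R η) : f * g * h = f * (g * h) := by
  ext α hα
  have key1 : ∀ x ∈ Finset.HasAntidiagonal.antidiagonal α,
      paritySign (reorderParity η x.1 x.2) • ((f * g).coeff x.1 * h.coeff x.2) =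
      ∑ y ∈ Finset.HasAntidiagonal.antidiagonal x.1,
        (paritySign (reorderParity η (y.1 + y.2) x.2) * paritySign (reorderParity η y.1 y.2)) •
          (f.coeff y.1 * g.coeff y.2 * h.coeff x.2) := by
    intro x hx
    rw [Finset.HasAntidiagonal.mem_antidiagonal] at hx
    rw [coeff_mul _ _ (IsAdmissible.left (hx ▸ hα)), Finset.sum_mul, Finset.smul_sum]
    refine Finset.sum_congr rfl fun y hy => ?_
    rw [Finset.HasAntidiagonal.mem_antidiagonal] at hy
    rw [hy, smul_mul_assoc, mul_smul]
  have key2 : ∀ x ∈ Finset.HasAntidiagonal.antidiagonal α,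
      paritySign (reorderParity η x.1 x.2) • (f.coeff x.1 * (g * h).coeff x.2) =
      ∑ y ∈ Finset.HasAntidiagonal.antidiagonal x.2,
        (paritySign (reorderParity η x.1 (y.1 + y.2)) * paritySign (reorderParity η y.1 y.2)) •
          (f.coeff x.1 * (g.coeff y.1 * h.coeff y.2)) := by
    intro x hx
    rw [Finset.HasAntidiagonal.mem_antidiagonal] at hx
    rw [coeff_mul _ _ (IsAdmissible.right (hx ▸ hα)), Finset.mul_sum, Finset.smul_sum]
    refine Finset.sum_congr rfl fun y hy => ?_
    rw [Finset.HasAntidiagonal.mem_antidiagonal] at hy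
    rw [hy, mul_smul_comm, mul_smul]
  rw [coeff_mul _ _ hα, coeff_mul _ _ hα, Finset.sum_congr rfl key1, Finset.sum_congr rfl key2]
  simp only [Finset.sum_sigma']
  apply Finset.sum_nbij' (fun ⟨⟨_i, j⟩, ⟨k, l⟩⟩ ↦ ⟨(k, l + j), (l, j)⟩)
    (fun ⟨⟨i, _j⟩, ⟨k, l⟩⟩ ↦ ⟨(i + k, l), (i, k)⟩)
  · rintro ⟨⟨i, j⟩, ⟨k, l⟩⟩ hx
    simp only [Finset.mem_sigma, Finset.HasAntidiagonal.mem_antidiagonal] at hx ⊢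
    exact ⟨by rw [← add_assoc, hx.2, hx.1], trivial⟩
  · rintro ⟨⟨i, j⟩, ⟨k, l⟩⟩ hx
    simp only [Finset.mem_sigma, Finset.HasAntidiagonal.mem_antidiagonal] at hx ⊢
    exact ⟨by rw [add_assoc, hx.2, hx.1], trivial⟩
  · rintro ⟨⟨i, j⟩, ⟨k, l⟩⟩ hx
    simp only [Finset.mem_sigma, Finset.HasAntidiagonal.mem_antidiagonal] at hx ⊢
    rw [hx.2]
  · rintro ⟨⟨i, j⟩, ⟨k, l⟩⟩ hx
    simp only [Finset.mem_sigma, Finset.HasAntidiagonal.mem_antidiagonal] at hx ⊢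
    rw [hx.2]
  · rintro ⟨⟨i, j⟩, ⟨k, l⟩⟩ hx
    simp only [reorderParity_add_left, reorderParity_add_right, paritySign_add, mul_assoc]
    congr 1
    ring

noncomputable instance : Ring (FormalSeries R η) :=
  { (inferInstance : AddCommGroup (FormalSeries R η)) with
    mul := (· * ·)
    one := 1
    mul_assoc := FormalSeries.mul_assoc
    one_mul := fun f => by
      classical
      ext α hα
      rw [coeff_mul _ _ hα, Finset.sum_eq_single (0, α)]
      · simp [coeff_one, reorderParity_zero_left, paritySign_zero]
      · rintro ⟨i, j⟩ hij hne
        rw [Finset.HasAntidiagonal.mem_antidiagonal] at hij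
        rw [coeff_one, if_neg, zero_mul, smul_zero]
        rintro rfl
        exact hne (by simp_all)
      · simp
    mul_one := fun f => by
      classical
      ext α hα
      rw [coeff_mul _ _ hα, Finset.sum_eq_single (α, 0)]
      · simp [coeff_one, reorderParity_zero_right, paritySign_zero]
      · rintro ⟨i, j⟩ hij hne
        rw [Finset.HasAntidiagonal.mem_antidiagonal] at hij
        rw [coeff_one, if_neg, mul_zero, smul_zero]
        rintro rfl
        exact hne (by simp_all)
      · simp
    zero_mul := fun f => by
      ext α hα
      simp [coeff_mul _ _ hα, coeff_zero]
    mul_zero := fun f => by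
      ext α hα
      simp [coeff_mul _ _ hα, coeff_zero]
    left_distrib := fun f g h => by
      ext α hα
      simp [coeff_mul _ _ hα, coeff_add, mul_add, smul_add, Finset.sum_add_distrib]
    right_distrib := fun f g h => by
      ext α hα
      simp [coeff_mul _ _ hα, coeff_add, add_mul, smul_add, Finset.sum_add_distrib] }

noncomputable instance [Algebra ℝ R] : Algebra ℝ (FormalSeries R η) :=
  Algebra.ofModule
    (fun r f g => by
      ext α hα
      simp only [coeff_mul _ _ hα, coeff_smul, smul_mul_assoc, Finset.smul_sum]
      exact Finset.sum_congr rfl fun x _ => smul_comm _ _ _)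
    (fun r f g => by
      ext α hα
      simp only [coeff_mul _ _ hα, coeff_smul, mul_smul_comm, Finset.smul_sum]
      exact Finset.sum_congr rfl fun x _ => smul_comm _ _ _)

/-- The series is homogeneous of degree `a`: only monomials of degree `a` occur. -/
def IsHomogeneous (a : Z2n n) (f : FormalSeries R η) : Prop :=
  ∀ α, f.coeff α ≠ 0 → monomialDegree η α = a

/-- The coefficientwise application of a ring homomorphism. -/
def map {S : Type*} [CommRing S] (φ : R →+* S) (f : FormalSeries R η) : FormalSeries S η :=
  ⟨fun α => φ (f.coeff α), fun α h => by simp only [f.coeff_eq_zero h, map_zero]⟩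

end FormalSeries

end FormalSeries

/-- The smooth real functions on an open subset of `ℝᵖ`. -/
abbrev SmoothFunctions {p : ℕ} (V : Opens (EuclideanSpace ℝ (Fin p))) : Type :=
  C^∞⟮𝓘(ℝ, EuclideanSpace ℝ (Fin p)), V; 𝓘(ℝ, ℝ), ℝ⟯

/-- The restriction of smooth functions to a smaller open set. -/
noncomputable def SmoothFunctions.restrict {p : ℕ} {V W : Opens (EuclideanSpace ℝ (Fin p))}
    (h : W ≤ V) : SmoothFunctions V →+* SmoothFunctions W :=
  ContMDiffMap.restrictRingHom 𝓘(ℝ, EuclideanSpace ℝ (Fin p)) 𝓘(ℝ, ℝ) ℝ h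

/-! ### `ℤ₂ⁿ`-manifolds -/

/-- A locally `ℤ₂ⁿ`-ringed space. -/
structure Z2nRingedSpace (n : ℕ) where
  /-- The underlying topological space. -/
  space : TopCat.{u}
  t2 : T2Space space
  secondCountable : SecondCountableTopology space
  /-- The structure sheaf. -/
  sheaf : TopCat.Sheaf (AlgCat.{u} ℝ) space
  /-- The homogeneous sections over `U`. -/
  homog : ∀ U : Opens space, Z2n n → Submodule ℝ (sheaf.presheaf.obj (op U))
  /-- The sections over `U` form a `ℤ₂ⁿ`-graded algebra. -/
  graded : ∀ U, GradedAlgebra (homog U)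
  restrict_homog : ∀ {U V : Opens space} (h : V ≤ U) (a : Z2n n), ∀ f ∈ homog U a,
    (sheaf.presheaf.map (homOfLE h).op).hom f ∈ homog V a
  graded_comm : ∀ (U : Opens space) (a b : Z2n n), ∀ f ∈ homog U a, ∀ h ∈ homog U b,
    f * h = koszulSign a b • (h * f)
  isLocalRing_stalk : ∀ x : space,
    IsLocalRing
    (TopCat.Presheaf.stalk (C := RingCat.{u}) (sheaf.presheaf ⋙ forget₂ (AlgCat.{u} ℝ) RingCat.{u}) x)

namespace Z2nRingedSpace

variable {n : ℕ} (M : Z2nRingedSpace.{u} n)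

/-- The algebra of sections of the structure sheaf over `U`. -/
abbrev Sections (U : Opens M.space) : Type u := M.sheaf.presheaf.obj (op U)

/-- The restriction of sections. -/
def restrict {U V : Opens M.space} (h : V ≤ U) : M.Sections U →ₐ[ℝ] M.Sections V :=
  (M.sheaf.presheaf.map (homOfLE h).op).hom

/-- The algebra `C^∞(M)` of functions: the global sections of the structure sheaf. -/
abbrev Functions : Type u := M.Sections ⊤

/-- The restriction of a function to `V`. -/
def res (V : Opens M.space) : M.Functions →ₐ[ℝ] M.Sections V := M.restrict le_top

/-- The part of the domain of an open partial homeomorphism that is mapped into `V`. -/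
def preimage {p : ℕ} (φ : OpenPartialHomeomorph M.space (EuclideanSpace ℝ (Fin p)))
    (V : Opens (EuclideanSpace ℝ (Fin p))) : Opens M.space :=
  ⟨φ.source ∩ φ ⁻¹' V, φ.isOpen_inter_preimage V.isOpen⟩

theorem preimage_mono {p : ℕ} (φ : OpenPartialHomeomorph M.space (EuclideanSpace ℝ (Fin p)))
    {V W : Opens (EuclideanSpace ℝ (Fin p))} (h : W ≤ V) : M.preimage φ W ≤ M.preimage φ V :=
  fun _ hx => ⟨hx.1, h hx.2⟩

/-- A chart with values in `ℝ^{p|q}`: a homeomorphism of an open subset of the space onto an open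
subset of `ℝᵖ`, covered by an isomorphism of the sheaves of graded algebras
`C^∞(-)[[ξ]]` and the structure sheaf. -/
structure Chart (p : ℕ) {N : ℕ} (η : Fin N → Z2n n) where
  /-- The underlying homeomorphism. -/
  toHomeo : OpenPartialHomeomorph M.space (EuclideanSpace ℝ (Fin p))
  /-- The isomorphism of sections over `V` and over the preimage of `V`. -/
  iso : ∀ V : Opens (EuclideanSpace ℝ (Fin p)), (V : Set _) ⊆ toHomeo.target →
    FormalSeries (SmoothFunctions V) η ≃ₐ[ℝ]
      M.Sections (M.preimage toHomeo V)
  iso_homog : ∀ (V : Opens (EuclideanSpace ℝ (Fin p)))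
    (hV : (V : Set _) ⊆ toHomeo.target) (a : Z2n n)
    (f : FormalSeries (SmoothFunctions V) η), f.IsHomogeneous a → iso V hV f ∈ M.homog _ a
  iso_restrict : ∀ (V W : Opens (EuclideanSpace ℝ (Fin p))) (hV : (V : Set _) ⊆ toHomeo.target)
    (h : W ≤ V) (f : FormalSeries (SmoothFunctions V) η),
    iso W (subset_trans h hV) (f.map (SmoothFunctions.restrict h)) =
      M.restrict (M.preimage_mono toHomeo h) (iso V hV f)

end Z2nRingedSpace

/-- A smooth `ℤ₂ⁿ`-manifold of dimension `p|q`: a locally `ℤ₂ⁿ`-ringed space that is locally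
isomorphic to `ℝ^{p|q}`. Here `q` is given by the list of the nonzero degrees of the formal
coordinates. -/
structure Z2nManifold (n : ℕ) extends Z2nRingedSpace.{u} n where
  /-- The number of degree-zero coordinates. -/
  dimBody : ℕ
  /-- The number of formal coordinates. -/
  dimFormal : ℕ
  /-- The degrees of the formal coordinates. -/
  formalDegree : Fin dimFormal → Z2n n
  formalDegree_ne_zero : ∀ A, formalDegree A ≠ 0
  exists_chart : ∀ x : space, ∃ φ : toZ2nRingedSpace.Chart dimBody formalDegree,
    x ∈ φ.toHomeo.source

namespace Z2nManifold

variable {n : ℕ} (M : Z2nManifold.{u} n)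

/-! ### Vector fields -/

/-- The functions that are homogeneous of degree `a`. -/
abbrev HomogFunctions (a : Z2n n) : Submodule ℝ M.Functions := M.homog ⊤ a

/-- `D` is a derivation of `C^∞(M)` that is homogeneous of degree `d`. -/
structure IsHomogDerivation (d : Z2n n) (D : M.Functions →ₗ[ℝ] M.Functions) : Prop where
  degree : ∀ a, ∀ f ∈ M.HomogFunctions a, D f ∈ M.HomogFunctions (d + a)
  leibniz : ∀ a, ∀ f ∈ M.HomogFunctions a, ∀ h,
    D (f * h) = D f * h + koszulSign d a • (f * D h)

theorem IsHomogDerivation.zero (d : Z2n n) : M.IsHomogDerivation d 0 where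
  degree _ _ _ := Submodule.zero_mem _
  leibniz _ _ _ _ := by simp

variable {M} in
theorem IsHomogDerivation.add {d : Z2n n} {D D' : M.Functions →ₗ[ℝ] M.Functions}
    (hD : M.IsHomogDerivation d D) (hD' : M.IsHomogDerivation d D') :
    M.IsHomogDerivation d (D + D') where
  degree a f hf := Submodule.add_mem _ (hD.degree a f hf) (hD'.degree a f hf)
  leibniz a f hf h := by
    simp only [LinearMap.add_apply, hD.leibniz a f hf h, hD'.leibniz a f hf h, add_mul, mul_add,
      smul_add]
    abel

variable {M} in
theorem IsHomogDerivation.smul {d b : Z2n n} {D : M.Functions →ₗ[ℝ] M.Functions}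
    (hD : M.IsHomogDerivation d D) {k : M.Functions} (hk : k ∈ M.HomogFunctions b) :
    M.IsHomogDerivation (b + d) (k • D) where
  degree a f hf := by
    have := M.graded ⊤
    rw [add_assoc]
    exact SetLike.mul_mem_graded hk (hD.degree a f hf)
  leibniz a f hf h := by
    simp only [LinearMap.smul_apply, smul_eq_mul, hD.leibniz a f hf h, mul_add, mul_smul_comm,
      ← mul_assoc]
    rw [M.graded_comm ⊤ b a k hk f hf, koszulSign_add_left, mul_comm, mul_smul, smul_mul_assoc]

/-- The left `C^∞(M)`-module `Vect(M)` of vector fields: the sums of homogeneous derivations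
of `C^∞(M)`. -/
def vect : Submodule M.Functions (M.Functions →ₗ[ℝ] M.Functions) where
  carrier := {D | ∃ c : Z2n n → (M.Functions →ₗ[ℝ] M.Functions),
    (∀ d, M.IsHomogDerivation d (c d)) ∧ D = ∑ d, c d}
  add_mem' := by
    rintro _ _ ⟨c, hc, rfl⟩ ⟨c', hc', rfl⟩
    exact ⟨fun d => c d + c' d, fun d => (hc d).add (hc' d), by rw [Finset.sum_add_distrib]⟩
  zero_mem' := ⟨0, fun d => .zero M d, by simp⟩
  smul_mem' := by
    rintro k _ ⟨c, hc, rfl⟩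
    have := M.graded ⊤
    classical
    have sum_mem : ∀ (s : Finset (Z2n n)) (c : Z2n n → Z2n n → (M.Functions →ₗ[ℝ] M.Functions)),
        (∀ b d, M.IsHomogDerivation d (c b d)) →
        ∀ d, M.IsHomogDerivation d (∑ b ∈ s, c b d) := by
      intro s c hc d
      induction s using Finset.induction_on with
      | empty => simpa using IsHomogDerivation.zero M d
      | insert b s hb ih => rw [Finset.sum_insert hb]; exact (hc b d).add ih
    refine ⟨fun d => ∑ b, (DirectSum.decompose (M.homog ⊤) k b : M.Functions) • c (d - b),
      sum_mem _ (fun b d => (DirectSum.decompose (M.homog ⊤) k b : M.Functions) • c (d - b)) ?_, ?_⟩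
    · intro b d
      have h := (hc (d - b)).smul (DirectSum.decompose (M.homog ⊤) k b).2
      rwa [add_sub_cancel] at h
    · rw [Finset.sum_comm]
      have h1 : ∀ b, ∑ d, (DirectSum.decompose (M.homog ⊤) k b : M.Functions) • c (d - b) =
          (DirectSum.decompose (M.homog ⊤) k b : M.Functions) • ∑ d, c d := by
        intro b
        rw [← Finset.smul_sum]
        congr 1
        exact Equiv.sum_comp (Equiv.subRight b) c
      rw [Finset.sum_congr rfl fun b _ => h1 b, ← Finset.sum_smul]
      congr 1
      conv_lhs => rw [← DirectSum.sum_support_decompose (M.homog ⊤) k]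
      refine Finset.sum_subset (Finset.subset_univ _) fun b _ hb => ?_
      simpa using hb

/-- The vector fields on `M`. -/
abbrev Vect : Type u := M.vect

variable {M}

/-- The function `X(f)`. -/
def Vect.app (X : M.Vect) (f : M.Functions) : M.Functions := X.1 f

/-- The vector field `X` is homogeneous of degree `d`. -/
def Vect.IsHomog (X : M.Vect) (d : Z2n n) : Prop := M.IsHomogDerivation d X.1

/-- The graded commutator `X Y - (-1)^⟨a, b⟩ Y X` of vector fields of degrees `a` and `b`,
as an operator on functions. -/
def gradedBracket (a b : Z2n n) (X Y : M.Vect) : M.Functions →ₗ[ℝ] M.Functions :=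
  X.1 ∘ₗ Y.1 - koszulSign a b • (Y.1 ∘ₗ X.1)

/-- The matrix `c` consists of the components `(Z_I)^J` of the vector fields `Z_I` over `V` with
respect to the vector fields `E_J`: one has `Z_I = ∑_J (Z_I)^J E_J` over `V`. -/
def IsComponents (V : Opens M.space) {k m : ℕ} (E : Fin m → M.Vect) (Z : Fin k → M.Vect)
    (c : Matrix (Fin k) (Fin m) (M.Sections V)) : Prop :=
  ∀ I, ∀ f : M.Functions, M.res V ((Z I).app f) = ∑ J, c I J * M.res V ((E J).app f)

/-- The homogeneous vector fields `E_1, …, E_m`, of degrees `e_1, …, e_m`, restrict to a frame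
over `V`: over `V` every vector field is a combination of them, with unique coefficients in the
sections over `V`. (A function or vector field defined near a point agrees, near that point, with a
global one. In particular the coordinate vector fields of a chart give frames near every point.) -/
structure IsFrame (V : Opens M.space) {m : ℕ} (E : Fin m → M.Vect) (e : Fin m → Z2n n) :
    Prop where
  homog : ∀ I, (E I).IsHomog (e I)
  existsUnique_components : ∀ Z : M.Vect,
    ∃! c : Matrix (Fin 1) (Fin m) (M.Sections V), IsComponents V E (fun _ => Z) c

/-- The function `t` is the graded trace of the left `C^∞(M)`-linear endomorphism `A` of degree `d`
of the vector fields: with respect to every frame, with `A(E_I) = ∑_J A_I^J E_J`, it is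
`∑_I (-1)^⟨deg I, deg I + d⟩ A_I^I`. -/
def IsGradedTrace (d : Z2n n) (A : M.Vect →ₗ[M.Functions] M.Vect) (t : M.Functions) : Prop :=
  ∀ (V : Opens M.space) (m : ℕ) (E : Fin m → M.Vect) (e : Fin m → Z2n n), IsFrame V E e →
    ∀ c : Matrix (Fin m) (Fin m) (M.Sections V), IsComponents V E (fun I => A (E I)) c →
      M.res V t = ∑ I, koszulSign (e I) (e I + d) • c I I

/-! ### Riemannian metrics, connections and the connection Laplacian -/

variable (M) in
/-- A Riemannian metric, given by the pairing `⟨X | Y⟩` of vector fields. It is homogeneous,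
`ℤ₂ⁿ`-symmetric, `C^∞(M)`-linear and non-degenerate: with respect to every local frame the matrix
`g_{IJ} = ⟨E_I | E_J⟩` has a (two-sided) inverse. -/
structure RiemannianMetric where
  /-- The degree of the metric. -/
  deg : Z2n n
  /-- The pairing `⟨X | Y⟩`. -/
  pairing : M.Vect → M.Vect → M.Functions
  homog : ∀ a b X Y, X.IsHomog a → Y.IsHomog b → pairing X Y ∈ M.HomogFunctions (a + b + deg)
  symm : ∀ a b X Y, X.IsHomog a → Y.IsHomog b → pairing X Y = koszulSign a b • pairing Y X
  add_left : ∀ X Y Z, pairing (X + Y) Z = pairing X Z + pairing Y Z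
  add_right : ∀ X Y Z, pairing X (Y + Z) = pairing X Y + pairing X Z
  smul_left : ∀ (f : M.Functions) X Y, pairing (f • X) Y = f * pairing X Y
  nondegenerate : ∀ (V : Opens M.space) (m : ℕ) (E : Fin m → M.Vect) (e : Fin m → Z2n n),
    IsFrame V E e →
      IsUnit (Matrix.of fun I J => M.res V (pairing (E I) (E J)) :
        Matrix (Fin m) (Fin m) (M.Sections V))

variable (M) in
/-- An affine connection. -/
structure AffineConnection where
  /-- The covariant derivative `∇_X Y`. -/
  nabla : M.Vect → M.Vect → M.Vect
  homog : ∀ a b X Y, X.IsHomog a → Y.IsHomog b → (nabla X Y).IsHomog (a + b)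
  add_left : ∀ X Y Z, nabla (X + Y) Z = nabla X Z + nabla Y Z
  add_right : ∀ X Y Z, nabla X (Y + Z) = nabla X Y + nabla X Z
  smul_left : ∀ (f : M.Functions) X Y, nabla (f • X) Y = f • nabla X Y
  leibniz : ∀ a b X (f : M.Functions) Y, X.IsHomog a → f ∈ M.HomogFunctions b →
    nabla X (f • Y) = X.app f • Y + koszulSign a b • (f • nabla X Y)

/-- The connection is symmetric: its torsion `∇_X Y - (-1)^⟨X, Y⟩ ∇_Y X - [X, Y]` vanishes. -/
def AffineConnection.IsSymmetric (D : AffineConnection M) : Prop :=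
  ∀ a b X Y, X.IsHomog a → Y.IsHomog b →
    (D.nabla X Y).1 - koszulSign a b • (D.nabla Y X).1 - gradedBracket a b X Y = 0

/-- The connection is compatible with the metric. -/
def AffineConnection.IsMetricCompatible (D : AffineConnection M) (g : RiemannianMetric M) : Prop :=
  ∀ a b X Y Z, X.IsHomog a → Y.IsHomog b →
    X.app (g.pairing Y Z) =
      g.pairing (D.nabla X Y) Z + koszulSign a b • g.pairing Y (D.nabla X Z)

/-- `D` is the Levi-Civita connection of `g`. -/
structure AffineConnection.IsLeviCivita (D : AffineConnection M) (g : RiemannianMetric M) :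
    Prop where
  symmetric : D.IsSymmetric
  metricCompatible : D.IsMetricCompatible g

/-- The left `C^∞(M)`-linear endomorphism `Z ↦ ∇_Z X`. -/
def AffineConnection.derivativeOf (D : AffineConnection M) (X : M.Vect) :
    M.Vect →ₗ[M.Functions] M.Vect where
  toFun Z := D.nabla Z X
  map_add' Y Z := D.add_left Y Z X
  map_smul' f Z := D.smul_left f Z X

/-- The function `t` is the covariant divergence of the vector field `X` of degree `d`, that is,
the graded trace of `Z ↦ ∇_Z X`. -/
def AffineConnection.IsDivergence (D : AffineConnection M) (d : Z2n n) (X : M.Vect)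
    (t : M.Functions) : Prop :=
  IsGradedTrace d (D.derivativeOf X) t

/-- The vector field `G` is the gradient of the function `f` of degree `a`. -/
def RiemannianMetric.IsGradient (g : RiemannianMetric M) (a : Z2n n) (f : M.Functions)
    (G : M.Vect) : Prop :=
  ∀ X : M.Vect, X.app f = koszulSign a g.deg • g.pairing X G

/-- The linear operator `Δ` on functions is the connection Laplacian of `(M, g)`, where `D` is the
Levi-Civita connection: `Δ f` is the divergence of the gradient of `f`, for homogeneous `f` of any
degree `a` (the gradient then has degree `a + deg g`). -/
def RiemannianMetric.IsConnectionLaplacian (g : RiemannianMetric M) (D : AffineConnection M)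
    (Δ : M.Functions →ₗ[ℝ] M.Functions) : Prop :=
  ∀ a, ∀ f ∈ M.HomogFunctions a, ∃ G : M.Vect,
    g.IsGradient a f G ∧ D.IsDivergence (a + g.deg) G (Δ f)

end Z2nManifold

/-! ### Signs -/

/-! In a local frame `E_I`, let `B` be the inverse of the matrix of the metric and let `G` be the
gradient of `f`. The components of `∇_{E_I} G` are recovered by pairing with the `E_K` and
multiplying by `B`. So the divergence of `G` is a signed sum of terms `Hess f (E_I, E_K) B_{KI}`,
where metric compatibility turns `⟨∇_X G | Y⟩` into the Hessian up to sign
(`pairing_nabla_gradient`). Two symmetries now collide. Vanishing torsion makes the Hessian graded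
symmetric (`hessian_symm`). Inverting a graded symmetric matrix of degree `deg g` gives graded
symmetry only up to the factor `(-1)^⟨deg g, deg g⟩` (`exists_inverse`), which is `-1` for an odd
metric. Exchanging `I` and `K` therefore negates every term, and the sum equals its own negative
(`isDivergence_gradient_zero`).

The rest of the work makes this computation meaningful. Divergences are tested only against frames,
so frames must exist near every point (`exists_frame`). Vector fields are derivations of global
functions, so cut-off functions (`exists_cutoff`) are needed to localize them and to extend
coordinate derivations. The analytic core is `exists_local_coordinates`: a derivation that kills the
coordinates is zero, by Hadamard's lemma and induction on the order of vanishing in the formal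
variables.

Finally, non-degeneracy makes gradients unique, so local gradients glue (`exists_gradient`). This
shows that the zero map really is a Laplacian, and it forces every gradient to be homogeneous
(`IsGradient.isHomog`), as the sign computation requires. -/

theorem paritySign_mul_self (a : ZMod 2) : paritySign a * paritySign a = 1 := by
  revert a; decide

theorem koszulSign_mul_self {n : ℕ} (a b : Z2n n) : koszulSign a b * koszulSign a b = 1 :=
  paritySign_mul_self _

theorem koszulSign_symm {n : ℕ} (a b : Z2n n) : koszulSign a b = koszulSign b a := by
  simp [koszulSign, dotProduct_comm]

theorem koszulSign_add_right {n : ℕ} (a b c : Z2n n) :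
    koszulSign a (b + c) = koszulSign a b * koszulSign a c := by
  simp [koszulSign, dotProduct_add, paritySign_add]

theorem koszulSign_zero_left {n : ℕ} (a : Z2n n) : koszulSign 0 a = 1 := by
  simp [koszulSign, paritySign_zero]

theorem koszulSign_zero_right {n : ℕ} (a : Z2n n) : koszulSign a 0 = 1 := by
  simp [koszulSign, paritySign_zero]

theorem koszulSign_smul_smul {n : ℕ} {A : Type*} [AddCommGroup A] (a b : Z2n n) (x : A) :
    koszulSign a b • koszulSign a b • x = x := by
  rw [smul_smul, koszulSign_mul_self, one_smul]

theorem Z2n.add_self {n : ℕ} (a : Z2n n) : a + a = 0 := by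
  ext i; exact CharTwo.add_self_eq_zero _

theorem Z2n.add_add_cancel {n : ℕ} (a b : Z2n n) : a + (a + b) = b := by
  rw [← add_assoc, Z2n.add_self, zero_add]

/-- Squaring is the identity on `ℤ/2`, so `⟨a, a⟩` is the total degree of `a`. This is the only
point where oddness of the metric enters. -/
theorem koszulSign_self_of_isOddDegree {n : ℕ} {a : Z2n n} (h : IsOddDegree a) :
    koszulSign a a = -1 := by
  have h1 : a ⬝ᵥ a = 1 := by
    rw [← h, dotProduct]
    refine Finset.sum_congr rfl fun i _ => ?_
    generalize a i = x
    revert x; decide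
  rw [koszulSign, h1]; rfl

namespace Z2nRingedSpace

variable {n : ℕ} (M : Z2nRingedSpace.{u} n)

/-! ### Sections -/

variable {M} in
theorem restrict_restrict {U V W : Opens M.space} (h : V ≤ U) (h' : W ≤ V) (s : M.Sections U) :
    M.restrict h' (M.restrict h s) = M.restrict (h'.trans h) s := by
  have : M.sheaf.presheaf.map (homOfLE (h'.trans h)).op =
      M.sheaf.presheaf.map (homOfLE h).op ≫ M.sheaf.presheaf.map (homOfLE h').op := by
    rw [← Functor.map_comp]; rfl
  simp only [restrict]
  rw [this]; rfl

variable {M} in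
theorem restrict_self {U : Opens M.space} (s : M.Sections U) :
    M.restrict le_rfl s = s := by
  have : M.sheaf.presheaf.map (homOfLE (le_refl U)).op = 𝟙 _ := by
    rw [← CategoryTheory.Functor.map_id]; rfl
  simp only [restrict]
  rw [this]; rfl

variable {M} in
theorem restrict_res {U V : Opens M.space} (h : V ≤ U) (f : M.Functions) :
    M.restrict h (M.res U f) = M.res V f := restrict_restrict _ _ _

variable {M} in
theorem res_eq_of_le {U V : Opens M.space} (h : V ≤ U) {f f' : M.Functions}
    (hf : M.res U f = M.res U f') : M.res V f = M.res V f' := by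
  rw [← restrict_res h, hf, restrict_res]

variable {M} in
theorem section_ext {V : Opens M.space} {s t : M.Sections V}
    (H : ∀ x ∈ V, ∃ (W : Opens M.space) (h : W ≤ V), x ∈ W ∧ M.restrict h s = M.restrict h t) :
    s = t := by
  choose W hW hx hst using fun x : V => H x.1 x.2
  refine TopCat.Sheaf.eq_of_locally_eq' M.sheaf W V (fun x => homOfLE (hW x)) ?_ s t hst
  intro x hxV
  exact Opens.mem_iSup.2 ⟨⟨x, hxV⟩, hx _⟩

variable {M} in
theorem function_ext {f f' : M.Functions}
    (H : ∀ x, ∃ W : Opens M.space, x ∈ W ∧ M.res W f = M.res W f') : f = f' :=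
  section_ext fun x _ => let ⟨W, hx, h⟩ := H x; ⟨W, le_top, hx, h⟩

variable {M} in
theorem res_ext {V : Opens M.space} {f f' : M.Functions}
    (H : ∀ x ∈ V, ∃ W : Opens M.space, x ∈ W ∧ M.res W f = M.res W f') :
    M.res V f = M.res V f' :=
  section_ext fun x hx => by
    obtain ⟨W, hW, h⟩ := H x hx
    refine ⟨W ⊓ V, inf_le_right, ⟨hW, hx⟩, ?_⟩
    rw [restrict_res, restrict_res]
    exact res_eq_of_le inf_le_left h

theorem exists_glue {ι : Type*} (U : ι → Opens M.space) (hU : ∀ x, ∃ i, x ∈ U i)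
    (s : ∀ i, M.Sections (U i))
    (hs : ∀ i j, M.restrict (inf_le_left : U i ⊓ U j ≤ U i) (s i) =
      M.restrict (inf_le_right : U i ⊓ U j ≤ U j) (s j)) :
    ∃ f : M.Functions, ∀ i, M.res (U i) f = s i := by
  obtain ⟨f, hf, -⟩ := TopCat.Sheaf.existsUnique_gluing' M.sheaf U ⊤ (fun i => homOfLE le_top)
    (fun x _ => Opens.mem_iSup.2 (hU x)) s hs
  exact ⟨f, hf⟩

/-! ### Homogeneous components -/

/-- The homogeneous component of degree `a`. -/
noncomputable def component (U : Opens M.space) (a : Z2n n) : M.Sections U →ₗ[ℝ] M.Sections U :=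
  letI := M.graded U
  (M.homog U a).subtype ∘ₗ DirectSum.component ℝ (Z2n n) (fun a => M.homog U a) a ∘ₗ
    (DirectSum.decomposeLinearEquiv (M.homog U)).toLinearMap

variable {M} {U V : Opens M.space}

theorem component_mem (a : Z2n n) (s : M.Sections U) : M.component U a s ∈ M.homog U a :=
  Subtype.property _

theorem sum_component (s : M.Sections U) : ∑ a, M.component U a s = s := by
  classical
  let _ := M.graded U
  conv_rhs => rw [← DirectSum.sum_support_decompose (M.homog U) s]
  symm
  refine Finset.sum_subset (Finset.subset_univ _) fun a _ ha => ?_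
  simpa using ha

theorem component_of_mem {a : Z2n n} {s : M.Sections U} (h : s ∈ M.homog U a) :
    M.component U a s = s := by
  let _ := M.graded U
  exact DirectSum.decompose_of_mem_same _ h

theorem component_of_mem_ne {a b : Z2n n} {s : M.Sections U} (h : s ∈ M.homog U a) (hab : a ≠ b) :
    M.component U b s = 0 := by
  let _ := M.graded U
  exact DirectSum.decompose_of_mem_ne _ h hab

theorem component_sum {c : Z2n n → M.Sections U} (hc : ∀ a, c a ∈ M.homog U a) (b : Z2n n) :
    M.component U b (∑ a, c a) = c b := by
  rw [map_sum, Finset.sum_eq_single b (fun a _ h => component_of_mem_ne (hc a) h) (by simp),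
    component_of_mem (hc b)]

theorem restrict_mem (h : V ≤ U) {a : Z2n n} {s : M.Sections U} (hs : s ∈ M.homog U a) :
    M.restrict h s ∈ M.homog V a := M.restrict_homog h a s hs

theorem restrict_component (h : V ≤ U) (a : Z2n n) (s : M.Sections U) :
    M.restrict h (M.component U a s) = M.component V a (M.restrict h s) := by
  conv_rhs => rw [← sum_component s, map_sum]
  rw [component_sum (c := fun a => M.restrict h (M.component U a s))
    fun a => restrict_mem h (component_mem a s)]

theorem res_mem (V : Opens M.space) {a : Z2n n} {f : M.Functions} (hf : f ∈ M.homog ⊤ a) :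
    M.res V f ∈ M.homog V a := restrict_mem _ hf

theorem mem_homog_iff_component_eq {a : Z2n n} {s : M.Sections U} :
    s ∈ M.homog U a ↔ M.component U a s = s :=
  ⟨component_of_mem, fun h => h ▸ component_mem a s⟩

/-- Homogeneity is the equation "component equals section", and both sides commute with restriction,
so the sheaf property applies. -/
theorem function_mem_homog_of_locally {a : Z2n n} {f : M.Functions}
    (H : ∀ x, ∃ W : Opens M.space, x ∈ W ∧ M.res W f ∈ M.homog W a) : f ∈ M.homog ⊤ a := by
  rw [mem_homog_iff_component_eq]
  refine function_ext fun x => ?_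
  obtain ⟨W, hx, hW⟩ := H x
  refine ⟨W, hx, ?_⟩
  rw [mem_homog_iff_component_eq] at hW
  exact (restrict_component _ _ _).trans hW

theorem mul_mem_homog {a b : Z2n n} {s t : M.Sections U} (hs : s ∈ M.homog U a)
    (ht : t ∈ M.homog U b) : s * t ∈ M.homog U (a + b) := by
  let _ := M.graded U
  exact SetLike.mul_mem_graded hs ht

theorem one_mem_homog : (1 : M.Sections U) ∈ M.homog U 0 := by
  let _ := M.graded U
  exact SetLike.one_mem_graded _

theorem zsmul_mem_homog {a : Z2n n} {s : M.Sections U} (k : ℤ) (hs : s ∈ M.homog U a) :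
    k • s ∈ M.homog U a := zsmul_mem hs k

theorem component_mul_left {a b : Z2n n} {s : M.Sections U} (t : M.Sections U)
    (hs : s ∈ M.homog U a) : M.component U (a + b) (s * t) = s * M.component U b t := by
  conv_lhs => rw [← sum_component t, Finset.mul_sum, map_sum]
  rw [Finset.sum_eq_single b]
  · exact component_of_mem (mul_mem_homog hs (component_mem b t))
  · intro c _ hc
    exact component_of_mem_ne (mul_mem_homog hs (component_mem c t)) (by simpa using hc)
  · simp

theorem mul_comm_of_mem {a b : Z2n n} {s t : M.Sections U} (hs : s ∈ M.homog U a)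
    (ht : t ∈ M.homog U b) : s * t = koszulSign a b • (t * s) := M.graded_comm U a b s hs t ht

theorem commute_of_mem_zero {s : M.Sections U} (hs : s ∈ M.homog U 0) (t : M.Sections U) :
    s * t = t * s := by
  rw [← sum_component t, Finset.mul_sum, Finset.sum_mul]
  refine Finset.sum_congr rfl fun a _ => ?_
  rw [mul_comm_of_mem hs (component_mem a t), koszulSign_zero_left, one_smul]

end Z2nRingedSpace

/-! ### Smooth functions on open subsets of `ℝᵖ` -/

/-- The integral is a convolution, evaluated at `0`, of the indicator of `(0, 1]` with `s ↦ β(s)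
H(x, -s)`. The bump `β` supplies the compact support needed for smooth dependence on `x`, and it is
one on `[-1, 1]`, so it does not change the value. -/
theorem ContDiff.intervalIntegral_of_uncurry {P : Type*} [NormedAddCommGroup P] [NormedSpace ℝ P]
    {H : P × ℝ → ℝ} (hH : ContDiff ℝ ∞ H) :
    ContDiff ℝ ∞ fun x => ∫ t in (0 : ℝ)..1, H (x, t) := by
  let β : ContDiffBump (0 : ℝ) := ⟨1, 2, one_pos, one_lt_two⟩
  let k : ℝ → ℝ := Set.indicator (Set.Ioc 0 1) 1
  have key := MeasureTheory.contDiffOn_convolution_right_with_param_comp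
    (μ := MeasureTheory.volume) (n := ⊤)
    (ContinuousLinearMap.lsmul ℝ ℝ : ℝ →L[ℝ] ℝ →L[ℝ] ℝ) (s := (Set.univ : Set P))
    (v := fun _ => (0 : ℝ)) contDiffOn_const (f := k) (g := fun x s => β s * H (x, -s))
    (k := Metric.closedBall 0 2) isOpen_univ (isCompact_closedBall _ _) ?_ ?_ ?_
  · rw [contDiffOn_univ] at key
    convert! key using 2 with x
    rw [MeasureTheory.convolution, intervalIntegral.integral_of_le zero_le_one,
      ← MeasureTheory.integral_indicator measurableSet_Ioc]
    congr 1
    ext t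
    by_cases ht : t ∈ Set.Ioc (0 : ℝ) 1
    · have : β (-t) = 1 := β.one_of_mem_closedBall (by
        rw [mem_closedBall_zero_iff, norm_neg, Real.norm_of_nonneg ht.1.le]; exact ht.2)
      simp [k, ht, this]
    · simp [k, ht]
  · intro x s _ hs
    rw [β.zero_of_le_dist, zero_mul]
    simp only [Metric.mem_closedBall, not_le] at hs
    exact hs.le
  · refine MeasureTheory.IntegrableOn.integrable_indicator ?_ measurableSet_Ioc
      |>.locallyIntegrable
    exact MeasureTheory.integrableOn_const (by simp)
  · refine ContDiff.contDiffOn ?_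
    have h1 : ContDiff ℝ ∞ fun q : P × ℝ => β q.2 := β.contDiff.comp contDiff_snd
    have h2 : ContDiff ℝ ∞ fun q : P × ℝ => H (q.1, -q.2) :=
      hH.comp (contDiff_fst.prodMk contDiff_snd.neg)
    exact h1.mul h2

/-- Hadamard's lemma on a Euclidean space. -/
theorem exists_hadamard_decomposition {p : ℕ} {F : EuclideanSpace ℝ (Fin p) → ℝ}
    (hF : ContDiff ℝ ∞ F) (y : EuclideanSpace ℝ (Fin p)) :
    ∃ G : Fin p → EuclideanSpace ℝ (Fin p) → ℝ, (∀ i, ContDiff ℝ ∞ (G i)) ∧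
      ∀ x, F x = F y + ∑ i, (x i - y i) * G i x := by
  have hF' : ContDiff ℝ ∞ (fderiv ℝ F) := hF.fderiv_right (by simp)
  have hpath : ContDiff ℝ ∞ fun q : EuclideanSpace ℝ (Fin p) × ℝ => y + q.2 • (q.1 - y) :=
    contDiff_const.add (contDiff_snd.smul (contDiff_fst.sub contDiff_const))
  have hH : ∀ v, ContDiff ℝ ∞ fun q : EuclideanSpace ℝ (Fin p) × ℝ =>
      fderiv ℝ F (y + q.2 • (q.1 - y)) v :=
    fun v => (hF'.comp hpath).clm_apply contDiff_const
  -- Integrate the derivative of `F` along the segment from `y` to `x` and expand `x - y` in the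
  -- standard basis.
  refine ⟨fun i x => ∫ t in (0 : ℝ)..1,
    fderiv ℝ F (y + t • (x - y)) (EuclideanSpace.single i 1), fun i => ?_, fun x => ?_⟩
  · exact ContDiff.intervalIntegral_of_uncurry (hH _)
  · have hcont : ∀ v, Continuous fun t : ℝ => fderiv ℝ F (y + t • (x - y)) v := fun v =>
      (hH v).continuous.comp (continuous_const.prodMk continuous_id)
    have hderiv : ∀ t ∈ Set.uIcc (0 : ℝ) 1, HasDerivAt (fun t : ℝ => F (y + t • (x - y)))
        (fderiv ℝ F (y + t • (x - y)) (x - y)) t := by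
      intro t _
      have h1 : HasDerivAt (fun t : ℝ => y + t • (x - y)) (x - y) t := by
        simpa using ((hasDerivAt_id t).smul_const (x - y)).const_add y
      have h2 := (hF.differentiable (by simp) (y + t • (x - y))).hasFDerivAt
      exact h2.comp_hasDerivAt t h1
    have := intervalIntegral.integral_eq_sub_of_hasDerivAt hderiv
      ((hcont _).intervalIntegrable _ _)
    simp only [one_smul, add_sub_cancel, zero_smul, add_zero] at this
    rw [← sub_eq_iff_eq_add', ← this]
    simp only [← intervalIntegral.integral_const_mul]
    rw [← intervalIntegral.integral_finsetSum
      fun i _ => (((hcont _).const_mul _).intervalIntegrable _ _)]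
    congr 1
    ext t
    have hx : x - y = ∑ i, (x i - y i) • EuclideanSpace.single i (1 : ℝ) := by
      ext j
      simp [Finset.sum_apply, Pi.single_apply]
    have hlin : ∀ L : EuclideanSpace ℝ (Fin p) →L[ℝ] ℝ,
        L (x - y) = ∑ i, (x i - y i) * L (EuclideanSpace.single i 1) := fun L => by
      conv_lhs => rw [hx, map_sum]
      simp
    exact hlin _

namespace SmoothFunctions

variable {p : ℕ} {V W : Opens (EuclideanSpace ℝ (Fin p))}

/-- The smooth function on `V` defined by a function that is smooth on `V`. -/
def ofContDiffOn (F : EuclideanSpace ℝ (Fin p) → ℝ) (hF : ContDiffOn ℝ ∞ F V) :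
    SmoothFunctions V :=
  ⟨fun x => F x, fun x => contMDiffAt_subtype_iff.2
    (hF.contDiffAt (V.isOpen.mem_nhds x.2)).contMDiffAt⟩

@[simp] theorem ofContDiffOn_apply (F : EuclideanSpace ℝ (Fin p) → ℝ) (hF : ContDiffOn ℝ ∞ F V)
    (x : V) : ofContDiffOn F hF x = F x := rfl

/-- The extension by zero. -/
noncomputable def extend (f : SmoothFunctions V) : EuclideanSpace ℝ (Fin p) → ℝ :=
  Function.extend Subtype.val f 0

@[simp] theorem extend_apply (f : SmoothFunctions V) (x : V) : f.extend x = f x :=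
  Subtype.val_injective.extend_apply _ _ _

theorem extend_of_mem (f : SmoothFunctions V) {x} (hx : x ∈ V) : f.extend x = f ⟨x, hx⟩ :=
  f.extend_apply ⟨x, hx⟩

theorem contDiffOn_extend (f : SmoothFunctions V) : ContDiffOn ℝ ∞ f.extend V := by
  intro x hx
  refine ContDiffAt.contDiffWithinAt (contMDiffAt_iff_contDiffAt.1 ?_)
  refine (contMDiffAt_subtype_iff (x := (⟨x, hx⟩ : V))).1 ?_
  have : (fun x : V => f.extend x) = f := by ext x; simp
  rw [this]
  exact f.contMDiff _

theorem differentiableAt_extend (f : SmoothFunctions V) (x : V) :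
    DifferentiableAt ℝ f.extend x :=
  ((f.contDiffOn_extend.contDiffAt (V.isOpen.mem_nhds x.2)).differentiableAt (by simp))

@[simp] theorem restrict_apply (h : W ≤ V) (f : SmoothFunctions V) (x : W) :
    restrict h f x = f ⟨x, h x.2⟩ := rfl

/-- The coordinate function `x_i`. -/
noncomputable def coord (V : Opens (EuclideanSpace ℝ (Fin p))) (i : Fin p) : SmoothFunctions V :=
  ofContDiffOn (fun x => x i) (by fun_prop)

@[simp] theorem coord_apply (i : Fin p) (x : V) : coord V i x = x.1 i := rfl

theorem contDiffOn_fderiv_extend (f : SmoothFunctions V) (v : EuclideanSpace ℝ (Fin p)) :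
    ContDiffOn ℝ ∞ (fun x => fderiv ℝ f.extend x v) V :=
  (f.contDiffOn_extend.fderiv_of_isOpen V.isOpen (by simp)).clm_apply contDiffOn_const

/-- The partial derivative `∂/∂x_i`. -/
noncomputable def pderiv (i : Fin p) : SmoothFunctions V →ₗ[ℝ] SmoothFunctions V where
  toFun f := ofContDiffOn (fun x => fderiv ℝ f.extend x (EuclideanSpace.single i 1))
    (f.contDiffOn_fderiv_extend _)
  map_add' f g := by
    ext x
    have h : (f + g).extend =ᶠ[nhds x.1] f.extend + g.extend := by
      filter_upwards [V.isOpen.mem_nhds x.2] with z hz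
      simp [extend_of_mem _ hz]
    simp [h.fderiv_eq, fderiv_add (f.differentiableAt_extend x) (g.differentiableAt_extend x)]
  map_smul' r f := by
    ext x
    have h : (r • f).extend =ᶠ[nhds x.1] r • f.extend := by
      filter_upwards [V.isOpen.mem_nhds x.2] with z hz
      simp [extend_of_mem _ hz]
    simp [h.fderiv_eq, fderiv_const_smul (f.differentiableAt_extend x)]

theorem pderiv_apply (i : Fin p) (f : SmoothFunctions V) (x : V) :
    pderiv i f x = fderiv ℝ f.extend x (EuclideanSpace.single i 1) := rfl

theorem pderiv_mul (i : Fin p) (f g : SmoothFunctions V) :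
    pderiv i (f * g) = pderiv i f * g + f * pderiv i g := by
  ext x
  have h : (f * g).extend =ᶠ[nhds x.1] f.extend * g.extend := by
    filter_upwards [V.isOpen.mem_nhds x.2] with z hz
    simp [extend_of_mem _ hz]
  rw [pderiv_apply, h.fderiv_eq, fderiv_mul (f.differentiableAt_extend x)
    (g.differentiableAt_extend x)]
  simp [pderiv_apply]
  ring

theorem pderiv_coord (i j : Fin p) : pderiv i (coord V j) = if i = j then 1 else 0 := by
  ext x
  have h : (coord V j).extend =ᶠ[nhds x.1] EuclideanSpace.proj (𝕜 := ℝ) j := by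
    filter_upwards [V.isOpen.mem_nhds x.2] with z hz
    simpa using (coord V j).extend_apply ⟨z, hz⟩
  rw [pderiv_apply, h.fderiv_eq, ContinuousLinearMap.fderiv]
  split_ifs with hij
  · simp [hij]
  · simp [Ne.symm hij]

/-- A smooth function that is one near `y` and vanishes outside a small closed ball. -/
theorem exists_bump (y : V) : ∃ (f : SmoothFunctions V) (K : Set (EuclideanSpace ℝ (Fin p)))
    (W : Opens (EuclideanSpace ℝ (Fin p))), IsCompact K ∧ K ⊆ V ∧ y.1 ∈ W ∧ W ≤ V ∧
      (∀ x : V, x.1 ∈ W → f x = 1) ∧ ∀ x : V, x.1 ∉ K → f x = 0 := by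
  obtain ⟨r, hr, hrV⟩ := Metric.nhds_basis_closedBall.mem_iff.1 (V.isOpen.mem_nhds y.2)
  let χ : ContDiffBump y.1 := ⟨r / 2, r, half_pos hr, half_lt_self hr⟩
  refine ⟨ofContDiffOn χ χ.contDiff.contDiffOn, Metric.closedBall y.1 r,
    ⟨Metric.ball y.1 (r / 2), Metric.isOpen_ball⟩, isCompact_closedBall _ _, hrV,
    Metric.mem_ball_self (half_pos hr), ?_, ?_, ?_⟩
  · exact fun x hx => hrV (Metric.ball_subset_closedBall (Metric.ball_subset_ball (by linarith) hx))
  · exact fun x hx => χ.one_of_mem_closedBall (Metric.ball_subset_closedBall hx)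
  · intro x hx
    refine χ.zero_of_le_dist ?_
    simp only [Metric.mem_closedBall, not_le] at hx
    exact hx.le

/-- Hadamard's lemma near a point. -/
theorem exists_hadamard (f : SmoothFunctions V) (y : V) :
    ∃ (h : Fin p → SmoothFunctions V) (W : Opens (EuclideanSpace ℝ (Fin p))), y.1 ∈ W ∧ W ≤ V ∧
      ∀ x : V, x.1 ∈ W → f x = f y + ∑ i, (x.1 i - y.1 i) * h i x := by
  obtain ⟨χ, K, W, hK, hKV, hyW, hWV, h1, h0⟩ := exists_bump y
  -- `V` need not contain the segments from `y`, so `f` is replaced by `χ f`. Its extension by zero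
  -- is smooth on the whole space and equals `f` near `y`.
  have hF : ContDiff ℝ ∞ (χ * f).extend := by
    rw [contDiff_iff_contDiffAt]
    intro x
    by_cases hx : x ∈ V
    · exact (χ * f).contDiffOn_extend.contDiffAt (V.isOpen.mem_nhds hx)
    · have : (χ * f).extend =ᶠ[nhds x] fun _ => 0 := by
        filter_upwards [hK.isClosed.isOpen_compl.mem_nhds fun h => hx (hKV h)] with z hz
        by_cases hzV : z ∈ V
        · have := (χ * f).extend_apply ⟨z, hzV⟩
          simpa [h0 ⟨z, hzV⟩ hz] using this
        · exact Function.extend_apply' _ _ _ (by simpa using hzV)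
      exact contDiffAt_const.congr_of_eventuallyEq this
  obtain ⟨G, hG, hFG⟩ := exists_hadamard_decomposition hF y.1
  refine ⟨fun i => ofContDiffOn (G i) (hG i).contDiffOn, W, hyW, hWV, fun x hx => ?_⟩
  have := hFG x
  simpa [h1 x hx, h1 y hyW] using this

end SmoothFunctions

/-! ### Calculus of formal series -/

section FormalSeries

variable {n N : ℕ} {η : Fin N → Z2n n}

open Finset.HasAntidiagonal (antidiagonal mem_antidiagonal)

/-- The pairs missed by the shift are those with `β i = 0`, which `hF` kills. In the Leibniz rule
for `∂/∂ξ_A` the weight `β A` plays this role. -/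
theorem sum_antidiagonal_add_single_left {A : Type*} [AddCommMonoid A] (i : Fin N)
    (α : Fin N →₀ ℕ) (F : (Fin N →₀ ℕ) → (Fin N →₀ ℕ) → A) (hF : ∀ β γ, β i = 0 → F β γ = 0) :
    ∑ x ∈ antidiagonal (α + Finsupp.single i 1), F x.1 x.2 =
      ∑ x ∈ antidiagonal α, F (x.1 + Finsupp.single i 1) x.2 := by
  symm
  refine Finset.sum_bij_ne_zero (fun x _ _ => (x.1 + Finsupp.single i 1, x.2)) ?_ ?_ ?_ ?_
  · rintro ⟨β, γ⟩ h -
    rw [mem_antidiagonal] at h ⊢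
    rw [← h, add_right_comm]
  · rintro ⟨β, γ⟩ _ _ ⟨β', γ'⟩ _ _ h
    simpa using h
  · rintro ⟨β, γ⟩ h h0
    rw [mem_antidiagonal] at h
    have hβ : Finsupp.single i 1 ≤ β := by
      rw [Finsupp.single_le_iff, Nat.one_le_iff_ne_zero]
      exact fun hi => h0 (hF _ _ hi)
    have h' : β - Finsupp.single i 1 + Finsupp.single i 1 = β := tsub_add_cancel_of_le hβ
    refine ⟨(β - Finsupp.single i 1, γ), ?_, ?_, ?_⟩
    · rw [mem_antidiagonal]
      rw [← h', add_right_comm] at h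
      exact add_right_cancel h
    · simpa only [h'] using h0
    · simp only [h']
  · intros; rfl

theorem sum_antidiagonal_add_single_right {A : Type*} [AddCommMonoid A] (i : Fin N)
    (α : Fin N →₀ ℕ) (F : (Fin N →₀ ℕ) → (Fin N →₀ ℕ) → A) (hF : ∀ β γ, γ i = 0 → F β γ = 0) :
    ∑ x ∈ antidiagonal (α + Finsupp.single i 1), F x.1 x.2 =
      ∑ x ∈ antidiagonal α, F x.1 (x.2 + Finsupp.single i 1) := by
  have := sum_antidiagonal_add_single_left i α (fun β γ => F γ β) fun β γ h => hF γ β h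
  have hswap : ∀ (α : Fin N →₀ ℕ) (H : (Fin N →₀ ℕ) × (Fin N →₀ ℕ) → A),
      ∑ x ∈ antidiagonal α, H x.swap = ∑ x ∈ antidiagonal α, H x := fun α H =>
    Finset.sum_nbij' Prod.swap Prod.swap (by simp [add_comm]) (by simp [add_comm]) (by simp)
      (by simp) (by simp)
  rw [← hswap, ← hswap α]
  exact this

theorem reorderParity_single_left (A : Fin N) (β : Fin N →₀ ℕ) :
    reorderParity η (Finsupp.single A 1) β =
      ∑ B, if B < A then (η A ⬝ᵥ η B) * (β B : ZMod 2) else 0 := by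
  rw [reorderParity, Finset.sum_eq_single A]
  · simp
  · intro C _ hC
    simp [hC.symm]
  · simp

theorem reorderParity_single_right (A : Fin N) (β : Fin N →₀ ℕ) :
    reorderParity η β (Finsupp.single A 1) =
      ∑ B, if A < B then (η A ⬝ᵥ η B) * (β B : ZMod 2) else 0 := by
  rw [reorderParity]
  refine Finset.sum_congr rfl fun B _ => ?_
  rw [Finset.sum_eq_single A]
  · simp [dotProduct_comm]
  · intro C _ hC
    simp [hC.symm]
  · simp

/-- Moving `ξ_A` through `ξ^β` passes the variables before `A`, those after `A`, and `ξ_A` itself.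
The three summands record these contributions. -/
theorem dotProduct_monomialDegree (A : Fin N) (β : Fin N →₀ ℕ) :
    η A ⬝ᵥ monomialDegree η β = reorderParity η (Finsupp.single A 1) β +
      reorderParity η β (Finsupp.single A 1) + (η A ⬝ᵥ η A) * (β A : ZMod 2) := by
  have h : (η A ⬝ᵥ η A) * (β A : ZMod 2) =
      ∑ B, if B = A then (η A ⬝ᵥ η B) * (β B : ZMod 2) else 0 := by simp
  rw [reorderParity_single_left, reorderParity_single_right, h, ← Finset.sum_add_distrib,
    ← Finset.sum_add_distrib, monomialDegree, dotProduct_sum]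
  refine Finset.sum_congr rfl fun B _ => ?_
  rw [dotProduct_smul, nsmul_eq_mul, mul_comm]
  rcases lt_trichotomy A B with h | h | h
  · simp [h, h.not_gt, h.ne']
  · simp [h]
  · simp [h, h.not_gt, h.ne]

theorem monomialDegree_add (α β : Fin N →₀ ℕ) :
    monomialDegree η (α + β) = monomialDegree η α + monomialDegree η β := by
  simp [monomialDegree, add_smul, Finset.sum_add_distrib]

theorem monomialDegree_zero : monomialDegree η 0 = 0 := by simp [monomialDegree]

theorem monomialDegree_single (A : Fin N) : monomialDegree η (Finsupp.single A 1) = η A := by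
  rw [monomialDegree, Finset.sum_eq_single A]
  · simp
  · intro B _ hB
    simp [hB.symm]
  · simp

theorem isAdmissible_single (A : Fin N) : IsAdmissible η (Finsupp.single A 1) := fun B _ => by
  rw [Finsupp.single_apply]; split_ifs <;> simp

/-! ### Constants, variables, and factoring variables out of a series -/

namespace FormalSeries

variable {R : Type*} [CommRing R]

theorem coeff_sum {ι : Type*} (s : Finset ι) (f : ι → FormalSeries R η) (α) :
    (∑ i ∈ s, f i).coeff α = ∑ i ∈ s, (f i).coeff α := by
  classical
  induction s using Finset.induction_on with
  | empty => rfl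
  | insert i s hi ih => rw [Finset.sum_insert hi, Finset.sum_insert hi, coeff_add, ih]

theorem coeff_sub (f g : FormalSeries R η) (α) : (f - g).coeff α = f.coeff α - g.coeff α := rfl

theorem coeff_zsmul (k : ℤ) (f : FormalSeries R η) (α) : (k • f).coeff α = k • f.coeff α := rfl

theorem coeff_map {S : Type*} [CommRing S] (φ : R →+* S) (f : FormalSeries R η) (α) :
    (f.map φ).coeff α = φ (f.coeff α) := rfl

/-- The constant series. -/
noncomputable def const (r : R) : FormalSeries R η :=
  ⟨fun α => if α = 0 then r else 0, fun α h => if_neg fun h0 : α = 0 => h (h0 ▸ .zero η)⟩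

theorem coeff_const (r : R) (α) : (const r : FormalSeries R η).coeff α = if α = 0 then r else 0 :=
  rfl

theorem coeff_const_mul (r : R) (f : FormalSeries R η) (α) :
    (const r * f).coeff α = r * f.coeff α := by
  by_cases h : IsAdmissible η α
  · rw [coeff_mul _ _ h, Finset.sum_eq_single (0, α)]
    · simp [coeff_const, reorderParity_zero_left, paritySign_zero]
    · rintro ⟨i, j⟩ hij hne
      rw [mem_antidiagonal] at hij
      rw [coeff_const, if_neg, zero_mul, smul_zero]
      rintro rfl
      exact hne (by simp_all)
    · simp
  · rw [coeff_eq_zero _ h, coeff_eq_zero _ h, mul_zero]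

theorem isHomogeneous_const (r : R) : (const r : FormalSeries R η).IsHomogeneous 0 := by
  intro α h
  rw [coeff_const] at h
  have : α = 0 := by by_contra h0; exact h (if_neg h0)
  rw [this, monomialDegree_zero]

theorem const_one : (const 1 : FormalSeries R η) = 1 := by
  classical
  ext α _
  rw [coeff_const, coeff_one]

theorem const_sub (r s : R) : (const (r - s) : FormalSeries R η) = const r - const s := by
  ext α _
  rw [coeff_sub, coeff_const, coeff_const, coeff_const]
  split_ifs <;> simp

theorem map_const {S : Type*} [CommRing S] (φ : R →+* S) (r : R) :
    (const r : FormalSeries R η).map φ = const (φ r) := by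
  ext α _
  rw [coeff_map, coeff_const, coeff_const]
  split_ifs <;> simp

/-- The variable `ξ_A`. -/
noncomputable def var (A : Fin N) : FormalSeries R η :=
  ⟨fun α => if α = Finsupp.single A 1 then 1 else 0,
    fun α h => if_neg fun h0 : α = _ => h (h0 ▸ isAdmissible_single A)⟩

theorem coeff_var (A : Fin N) (α) :
    (var A : FormalSeries R η).coeff α = if α = Finsupp.single A 1 then 1 else 0 :=
  rfl

theorem isHomogeneous_var (A : Fin N) : (var A : FormalSeries R η).IsHomogeneous (η A) := by
  intro α h
  rw [coeff_var] at h
  have : α = Finsupp.single A 1 := by by_contra h0; exact h (if_neg h0)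
  rw [this, monomialDegree_single]

theorem coeff_var_mul (A : Fin N) (f : FormalSeries R η) {β : Fin N →₀ ℕ}
    (h : IsAdmissible η (β + Finsupp.single A 1)) :
    (var A * f).coeff (β + Finsupp.single A 1) =
      paritySign (reorderParity η (Finsupp.single A 1) β) • f.coeff β := by
  rw [coeff_mul _ _ h, Finset.sum_eq_single (Finsupp.single A 1, β)]
  · simp [coeff_var]
  · rintro ⟨i, j⟩ hij hne
    rw [mem_antidiagonal] at hij
    rw [coeff_var, if_neg, zero_mul, smul_zero]
    rintro rfl
    refine hne ?_
    rw [add_comm β] at hij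
    exact Prod.ext rfl (add_left_cancel hij)
  · intro h
    exact absurd (mem_antidiagonal.2 (add_comm _ _)) h

theorem coeff_var_mul_of_eq_zero (A : Fin N) (f : FormalSeries R η) {α : Fin N →₀ ℕ}
    (hα : α A = 0) : (var A * f).coeff α = 0 := by
  by_cases h : IsAdmissible η α
  · rw [coeff_mul _ _ h]
    refine Finset.sum_eq_zero fun x hx => ?_
    rw [mem_antidiagonal] at hx
    rw [coeff_var, if_neg, zero_mul, smul_zero]
    intro h1
    have := DFunLike.congr_fun hx A
    simp [h1, hα] at this
  · exact coeff_eq_zero _ h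

/-- Multiplication by a variable raises the order of vanishing at a point. -/
theorem coeff_var_mul_vanishes {S : Type*} [CommRing S] (φ : R →+* S) (A : Fin N)
    {f : FormalSeries R η} {k : ℕ} (hf : ∀ α : Fin N →₀ ℕ, α.degree < k → φ (f.coeff α) = 0)
    {α : Fin N →₀ ℕ} (hα : α.degree < k + 1) : φ ((var A * f).coeff α) = 0 := by
  by_cases h0 : α A = 0
  · rw [coeff_var_mul_of_eq_zero A f h0, map_zero]
  · have h1 : α - Finsupp.single A 1 + Finsupp.single A 1 = α :=
      tsub_add_cancel_of_le (Finsupp.single_le_iff.2 (Nat.one_le_iff_ne_zero.2 h0))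
    by_cases h : IsAdmissible η α
    · rw [← h1] at h ⊢
      rw [coeff_var_mul A f h, map_zsmul, hf, smul_zero]
      rw [← h1, map_add, Finsupp.degree_single] at hα
      omega
    · rw [coeff_eq_zero _ h, map_zero]

open scoped Classical in
/-- A series without constant term is a combination of the variables. -/
theorem exists_eq_sum_var_mul (f : FormalSeries R η) :
    ∃ g : Fin N → FormalSeries R η, f = const (f.coeff 0) + ∑ A, var A * g A := by
  have hmin : ∀ (A : Fin N) (β : Fin N →₀ ℕ), (∀ B < A, β B = 0) →
      reorderParity η (Finsupp.single A 1) β = 0 := by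
    intro A β h
    rw [reorderParity_single_left]
    refine Finset.sum_eq_zero fun B _ => ?_
    split_ifs with hB
    · simp [h B hB]
    · rfl
  -- Each nonconstant monomial is assigned to its first variable `ξ_A`. That variable already stands
  -- in front, so factoring it out costs no sign.
  refine ⟨fun A => mk fun β => if ∀ B < A, β B = 0 then f.coeff (β + Finsupp.single A 1) else 0,
    ?_⟩
  ext α hα
  rw [coeff_add, coeff_const, coeff_sum]
  have hterm : ∀ A, (var A * (mk fun β => if ∀ B < A, β B = 0 then
      f.coeff (β + Finsupp.single A 1) else 0 : FormalSeries R η)).coeff α =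
      if (∀ B < A, α B = 0) ∧ α A ≠ 0 then f.coeff α else 0 := by
    intro A
    by_cases h0 : α A = 0
    · rw [coeff_var_mul_of_eq_zero _ _ h0, if_neg]
      tauto
    · have h1 : α - Finsupp.single A 1 + Finsupp.single A 1 = α :=
        tsub_add_cancel_of_le (Finsupp.single_le_iff.2 (Nat.one_le_iff_ne_zero.2 h0))
      have h2 : (∀ B < A, (α - Finsupp.single A 1 : Fin N →₀ ℕ) B = 0) ↔ ∀ B < A, α B = 0 := by
        refine forall₂_congr fun B hB => ?_
        simp [hB.ne']
      conv_lhs => rw [← h1]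
      rw [coeff_var_mul A _ (h1.symm ▸ hα), coeff_mk _ (IsAdmissible.left (h1.symm ▸ hα)), h1]
      by_cases h3 : ∀ B < A, α B = 0
      · rw [if_pos (h2.2 h3), hmin _ _ (h2.2 h3), paritySign_zero, one_smul, if_pos ⟨h3, h0⟩]
      · rw [if_neg (h2.not.2 h3), smul_zero, if_neg fun h => h3 h.1]
  simp only [hterm]
  by_cases h : α = 0
  · simp [h]
  · rw [if_neg h, zero_add]
    have hne : ∃ A, α A ≠ 0 := by
      by_contra h'
      push Not at h'
      exact h (Finsupp.ext h')
    obtain ⟨A, hA, hAmin⟩ := WellFounded.has_min (wellFounded_lt (α := Fin N)) {A | α A ≠ 0} hne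
    have hA' : ∀ B < A, α B = 0 := fun B hB => by
      by_contra h'
      exact hAmin B h' hB
    rw [Finset.sum_eq_single A, if_pos ⟨hA', hA⟩]
    · intro B _ hB
      refine if_neg fun ⟨h1, h2⟩ => ?_
      rcases lt_or_gt_of_ne hB with h3 | h3
      · exact h2 (hA' B h3)
      · exact hA (h1 A h3)
    · simp

/-! #### Homogeneous components -/

open scoped Classical in
/-- The homogeneous component of degree `a`. -/
noncomputable def homogComponent (a : Z2n n) (f : FormalSeries R η) : FormalSeries R η :=
  mk fun α => if monomialDegree η α = a then f.coeff α else 0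

theorem isHomogeneous_homogComponent (a : Z2n n) (f : FormalSeries R η) :
    (f.homogComponent a).IsHomogeneous a := by
  classical
  intro α h
  by_contra h1
  refine h ?_
  by_cases hα : IsAdmissible η α
  · rw [homogComponent, coeff_mk _ hα, if_neg h1]
  · exact coeff_eq_zero _ hα

theorem sum_homogComponent (f : FormalSeries R η) : ∑ a, f.homogComponent a = f := by
  classical
  ext α hα
  rw [coeff_sum]
  simp [homogComponent, coeff_mk _ hα]

/-! #### Derivatives -/

section Derivatives

variable [Algebra ℝ R]

/-- The coefficientwise application of a linear map. -/
def mapLinear (L : R →ₗ[ℝ] R) : FormalSeries R η →ₗ[ℝ] FormalSeries R η where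
  toFun f := ⟨fun α => L (f.coeff α), fun α h => by simp only [f.coeff_eq_zero h, map_zero]⟩
  map_add' f g := by ext α _; exact map_add L _ _
  map_smul' r f := by ext α _; exact map_smul L _ _

theorem coeff_mapLinear (L : R →ₗ[ℝ] R) (f : FormalSeries R η) (α) :
    (mapLinear L f).coeff α = L (f.coeff α) := rfl

theorem IsHomogeneous.mapLinear {a : Z2n n} {f : FormalSeries R η} (hf : f.IsHomogeneous a)
    (L : R →ₗ[ℝ] R) : (mapLinear L f).IsHomogeneous a := by
  intro α h
  refine hf α fun h0 => h ?_
  rw [coeff_mapLinear, h0, map_zero]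

theorem mapLinear_mul {L : R →ₗ[ℝ] R} (hL : ∀ r s, L (r * s) = L r * s + r * L s)
    (f g : FormalSeries R η) : mapLinear L (f * g) = mapLinear L f * g + f * mapLinear L g := by
  ext α hα
  rw [coeff_add, coeff_mapLinear, coeff_mul _ _ hα, coeff_mul _ _ hα, coeff_mul _ _ hα, map_sum,
    ← Finset.sum_add_distrib]
  refine Finset.sum_congr rfl fun x _ => ?_
  rw [map_zsmul, hL, smul_add]
  rfl

theorem mapLinear_const (L : R →ₗ[ℝ] R) (r : R) :
    mapLinear L (const r : FormalSeries R η) = const (L r) := by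
  ext α _
  rw [coeff_mapLinear, coeff_const, coeff_const]
  split_ifs <;> simp

theorem mapLinear_var {L : R →ₗ[ℝ] R} (hL : L 1 = 0) (A : Fin N) :
    mapLinear L (var A : FormalSeries R η) = 0 := by
  ext α _
  rw [coeff_mapLinear, coeff_var]
  split_ifs <;> simp [hL, coeff_zero]

open scoped Classical in
/-- The derivative `∂/∂ξ_A`. -/
noncomputable def varDeriv (A : Fin N) : FormalSeries R η →ₗ[ℝ] FormalSeries R η where
  -- Bringing `ξ_A` to the front of `ξ^(α+e_A)` costs the sign of passing the earlier variables. The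
  -- usual factor `α_A + 1` remains.
  toFun f := mk fun α =>
    (((α A + 1 : ℕ) : ℤ) * paritySign (reorderParity η (Finsupp.single A 1) α)) •
      f.coeff (α + Finsupp.single A 1)
  map_add' f g := by
    ext α hα
    rw [coeff_add, coeff_mk _ hα, coeff_mk _ hα, coeff_mk _ hα, coeff_add, smul_add]
  map_smul' r f := by
    ext α hα
    rw [RingHom.id_apply, coeff_smul, coeff_mk _ hα, coeff_mk _ hα, coeff_smul, smul_comm]

theorem coeff_varDeriv (A : Fin N) (f : FormalSeries R η) {α : Fin N →₀ ℕ}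
    (hα : IsAdmissible η α) : (varDeriv A f).coeff α =
      (((α A + 1 : ℕ) : ℤ) * paritySign (reorderParity η (Finsupp.single A 1) α)) •
        f.coeff (α + Finsupp.single A 1) := coeff_mk _ hα

theorem IsHomogeneous.varDeriv {a : Z2n n} {f : FormalSeries R η} (hf : f.IsHomogeneous a)
    (A : Fin N) : (varDeriv A f).IsHomogeneous (η A + a) := by
  intro α h
  have hα : IsAdmissible η α := by
    by_contra h0
    exact h (coeff_eq_zero _ h0)
  rw [coeff_varDeriv A f hα] at h
  have h1 := hf (α + Finsupp.single A 1) fun h0 => h (by rw [h0, smul_zero])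
  rw [← h1, monomialDegree_add, monomialDegree_single, add_comm (monomialDegree η α),
    Z2n.add_add_cancel]

theorem varDeriv_const (A : Fin N) (r : R) : varDeriv A (const r : FormalSeries R η) = 0 := by
  ext α hα
  rw [coeff_varDeriv _ _ hα, coeff_const, if_neg, smul_zero, coeff_zero]
  intro h
  simpa using DFunLike.congr_fun h A

theorem varDeriv_var (A B : Fin N) :
    varDeriv A (var B : FormalSeries R η) = if A = B then 1 else 0 := by
  classical
  ext α hα
  rw [coeff_varDeriv _ _ hα, coeff_var]
  by_cases hAB : A = B
  · subst hAB
    rw [if_pos rfl, coeff_one]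
    by_cases h : α = 0
    · simp [h, reorderParity_zero_right, paritySign_zero]
    · rw [if_neg, if_neg h, smul_zero]
      intro h'
      exact h (add_eq_right.1 h')
  · rw [if_neg hAB, if_neg, smul_zero, coeff_zero]
    intro h
    have := DFunLike.congr_fun h A
    simp [Ne.symm hAB] at this

theorem zmod_two_cases (z : ZMod 2) : z = 0 ∨ z = 1 := by revert z; decide

/-- All three coefficients become sums over pairs `β + γ = α + e_A` of multiples of `f_β g_γ`. Up to
a common sign the weights are `β_A + γ_A` on the left, and `β_A` and `± γ_A` on the right, the sign
being `(-1)^(⟨η_A, η_A⟩ β_A)`. They agree at once if `⟨η_A, η_A⟩ = 0`; otherwise the bound on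
exponents is needed. -/
theorem varDeriv_mul (A : Fin N) {a : Z2n n} {f : FormalSeries R η} (hf : f.IsHomogeneous a)
    (g : FormalSeries R η) : varDeriv A (f * g) =
      varDeriv A f * g + koszulSign (η A) a • (f * varDeriv A g) := by
  ext α hα
  set e : Fin N →₀ ℕ := Finsupp.single A 1 with he
  set s : ℤ := paritySign (reorderParity η e α) with hs
  have hsq := paritySign_mul_self
  have h1 : (varDeriv A f * g).coeff α = ∑ x ∈ antidiagonal (α + e),
      ((x.1 A : ℤ) * (s * paritySign (reorderParity η x.1 x.2))) •
        (f.coeff x.1 * g.coeff x.2) := by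
    rw [sum_antidiagonal_add_single_left A α (fun β γ =>
      ((β A : ℤ) * (s * paritySign (reorderParity η β γ))) • (f.coeff β * g.coeff γ)),
      coeff_mul _ _ hα]
    · refine Finset.sum_congr rfl fun x hx => ?_
      rw [mem_antidiagonal] at hx
      rw [coeff_varDeriv _ _ (IsAdmissible.left (hx.symm ▸ hα)), smul_mul_assoc, smul_smul]
      congr 1
      rw [hs, ← hx]
      simp only [← he, reorderParity_add_left, reorderParity_add_right, paritySign_add]
      have := hsq (reorderParity η e x.2)
      have h2 : ((x.1 + e) A : ℤ) = ((x.1 A + 1 : ℕ) : ℤ) := by simp [he]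
      rw [h2]
      linear_combination (- (((x.1 A + 1 : ℕ) : ℤ)) * paritySign (reorderParity η e x.1) *
        paritySign (reorderParity η x.1 x.2)) * this
    · intro β γ h
      simp [h]
  have h2 : koszulSign (η A) a • (f * varDeriv A g).coeff α = ∑ x ∈ antidiagonal (α + e),
      ((x.2 A : ℤ) * (paritySign ((η A ⬝ᵥ η A) * (x.1 A : ZMod 2)) *
        (s * paritySign (reorderParity η x.1 x.2)))) • (f.coeff x.1 * g.coeff x.2) := by
    rw [sum_antidiagonal_add_single_right A α (fun β γ =>
      ((γ A : ℤ) * (paritySign ((η A ⬝ᵥ η A) * (β A : ZMod 2)) *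
        (s * paritySign (reorderParity η β γ)))) • (f.coeff β * g.coeff γ)),
      coeff_mul _ _ hα, Finset.smul_sum]
    · refine Finset.sum_congr rfl fun x hx => ?_
      rw [mem_antidiagonal] at hx
      rw [coeff_varDeriv _ _ (IsAdmissible.right (hx.symm ▸ hα)), mul_smul_comm, smul_smul,
        smul_smul]
      by_cases h0 : f.coeff x.1 = 0
      · simp [h0]
      · congr 1
        rw [hs, ← hx, ← hf _ h0, koszulSign, dotProduct_monomialDegree]
        simp only [← he, reorderParity_add_right, paritySign_add]
        have h2 : ((x.2 + e) A : ℤ) = ((x.2 A + 1 : ℕ) : ℤ) := by simp [he]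
        rw [h2]
        ring
    · intro β γ h
      simp [h]
  rw [coeff_add, coeff_zsmul, h1, h2, ← Finset.sum_add_distrib, coeff_varDeriv _ _ hα]
  by_cases hadm : IsAdmissible η (α + e)
  · rw [coeff_mul _ _ hadm, Finset.smul_sum]
    refine Finset.sum_congr rfl fun x hx => ?_
    rw [mem_antidiagonal] at hx
    rw [smul_smul, ← add_smul]
    congr 1
    have hA : (x.1 A : ℤ) + x.2 A = ((α A + 1 : ℕ) : ℤ) := by
      have := DFunLike.congr_fun hx A
      simp only [he, Finsupp.add_apply, Finsupp.single_eq_same] at this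
      exact_mod_cast this
    rcases zmod_two_cases (η A ⬝ᵥ η A) with h | h
    · rw [h, zero_mul, paritySign_zero, ← hA]
      ring
    -- Here `ξ_A` squares to zero, so it occurs in exactly one of the two factors. The sign in front
    -- of `γ_A` matters only when `β_A = 0`, and then it is trivial.
    · have h3 := hadm A h
      have h4 : α A = 0 := by
        simp only [he, Finsupp.add_apply, Finsupp.single_eq_same] at h3
        omega
      rw [h4] at hA ⊢
      have h5 : (x.1 A = 0 ∧ x.2 A = 1) ∨ (x.1 A = 1 ∧ x.2 A = 0) := by omega
      rcases h5 with ⟨h5, h6⟩ | ⟨h5, h6⟩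
      · simp [h5, h6, paritySign_zero, hs, he]
      · simp [h5, h6, hs, he]
  -- The left side would involve `ξ_A²`, hence is zero. On the right `β_A + γ_A = 2`: either one
  -- exponent is inadmissible, or both are one and the two contributions cancel.
  · rw [coeff_eq_zero _ hadm, smul_zero]
    symm
    refine Finset.sum_eq_zero fun x hx => ?_
    rw [mem_antidiagonal] at hx
    have hAA : η A ⬝ᵥ η A = 1 := by
      by_contra h
      refine hadm fun B hB => ?_
      have hBA : B ≠ A := by rintro rfl; exact h hB
      simpa [he, Finsupp.single_apply, Ne.symm hBA] using hα B hB
    have hαA : α A = 1 := by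
      by_contra h
      refine hadm fun B hB => ?_
      by_cases hBA : B = A
      · have := hα A hAA
        subst hBA
        simp only [he, Finsupp.add_apply, Finsupp.single_eq_same]
        omega
      · simpa [he, Finsupp.single_apply, Ne.symm hBA] using hα B hB
    have hA : x.1 A + x.2 A = 2 := by
      have := DFunLike.congr_fun hx A
      simpa [he, hαA] using this
    have h5 : 2 ≤ x.1 A ∨ 2 ≤ x.2 A ∨ (x.1 A = 1 ∧ x.2 A = 1) := by omega
    rcases h5 with h5 | h5 | ⟨h5, h6⟩
    · rw [f.coeff_eq_zero fun h => absurd (h A hAA) (by omega)]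
      simp
    · rw [g.coeff_eq_zero fun h => absurd (h A hAA) (by omega)]
      simp
    · have h7 : paritySign 1 = -1 := rfl
      simp [h5, h6, hAA, h7]

end Derivatives

end FormalSeries

end FormalSeries

/-- The evaluation of smooth functions at a point. -/
noncomputable def SmoothFunctions.eval {p : ℕ} {V : Opens (EuclideanSpace ℝ (Fin p))} (x : V) :
    SmoothFunctions V →+* ℝ := ContMDiffMap.evalRingHom x

theorem SmoothFunctions.eval_apply {p : ℕ} {V : Opens (EuclideanSpace ℝ (Fin p))} (x : V)
    (f : SmoothFunctions V) : SmoothFunctions.eval x f = f x := rfl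

namespace Z2nRingedSpace

variable {n : ℕ} {M : Z2nRingedSpace.{u} n}

theorem exists_glue_pair {U C : Opens M.space} (hUC : ∀ z, z ∈ U ∨ z ∈ C) (s : M.Sections U)
    (t : M.Sections C) (h : M.restrict (inf_le_left : U ⊓ C ≤ U) s =
      M.restrict (inf_le_right : U ⊓ C ≤ C) t) :
    ∃ f : M.Functions, M.res U f = s ∧ M.res C f = t := by
  have h' : M.restrict (inf_le_left : C ⊓ U ≤ C) t = M.restrict (inf_le_right : C ⊓ U ≤ U) s := by
    have h1 : C ⊓ U ≤ U ⊓ C := (inf_comm C U).le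
    have := congrArg (M.restrict h1) h
    rw [restrict_restrict, restrict_restrict] at this
    exact this.symm
  obtain ⟨f, hf⟩ := M.exists_glue (fun b : Bool => cond b U C)
    (fun z => (hUC z).elim (fun h => ⟨true, h⟩) fun h => ⟨false, h⟩)
    (fun b => match b with | true => s | false => t)
    (fun b b' => match b, b' with
      | true, true => rfl | true, false => h | false, true => h' | false, false => rfl)
  exact ⟨f, hf true, hf false⟩

theorem function_ext_pair {U C : Opens M.space} (hUC : ∀ z, z ∈ U ∨ z ∈ C) {f f' : M.Functions}
    (hU : M.res U f = M.res U f') (hC : M.res C f = M.res C f') : f = f' :=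
  function_ext fun z => (hUC z).elim (fun h => ⟨U, h, hU⟩) fun h => ⟨C, h, hC⟩

/-! ### Charts: vanishing orders, coordinates and coordinate derivations -/

namespace Chart

variable {p N : ℕ} {η : Fin N → Z2n n} (φ : M.Chart p η)

/-- The range of the chart. -/
def target : Opens (EuclideanSpace ℝ (Fin p)) := ⟨φ.toHomeo.target, φ.toHomeo.open_target⟩

/-- The domain of the chart. -/
def domain : Opens M.space := M.preimage φ.toHomeo φ.target

theorem mem_domain {x : M.space} : x ∈ φ.domain ↔ x ∈ φ.toHomeo.source :=
  ⟨fun h => h.1, fun h => ⟨h, φ.toHomeo.map_source h⟩⟩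

theorem preimage_le_domain {W : Opens (EuclideanSpace ℝ (Fin p))} (hW : W ≤ φ.target) :
    M.preimage φ.toHomeo W ≤ φ.domain := M.preimage_mono φ.toHomeo hW

/-- The isomorphism of sections over the domain of the chart. -/
noncomputable def sections : FormalSeries (SmoothFunctions φ.target) η ≃ₐ[ℝ] M.Sections φ.domain :=
  φ.iso φ.target subset_rfl

/-- The image of a point in the domain. -/
def toTarget (x : φ.domain) : φ.target := ⟨φ.toHomeo x.1, x.2.2⟩

/-- A chart is only required to carry homogeneous series to homogeneous sections. The converse holds
because it then carries the decomposition of `f` to that of its image, and it is injective. -/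
theorem iso_mem_homog_iff {V : Opens (EuclideanSpace ℝ (Fin p))}
    (hV : (V : Set _) ⊆ φ.toHomeo.target) {a : Z2n n} {f : FormalSeries (SmoothFunctions V) η} :
    φ.iso V hV f ∈ M.homog _ a ↔ f.IsHomogeneous a := by
  refine ⟨fun h => ?_, φ.iso_homog V hV a f⟩
  have h1 := mem_homog_iff_component_eq.1 h
  conv_lhs at h1 => rw [← f.sum_homogComponent, map_sum]
  rw [component_sum (c := fun b => φ.iso V hV (f.homogComponent b))
    fun b => φ.iso_homog V hV b _ (f.isHomogeneous_homogComponent b)] at h1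
  rw [← (φ.iso V hV).injective h1]
  exact f.isHomogeneous_homogComponent a

theorem isHomogeneous_sections_symm {a : Z2n n} {s : M.Sections φ.domain}
    (hs : s ∈ M.homog _ a) : (φ.sections.symm s).IsHomogeneous a := by
  rw [← φ.iso_mem_homog_iff subset_rfl]
  change φ.sections _ ∈ _
  rwa [AlgEquiv.apply_symm_apply]

/-- The image in the range of the chart of the part of `U` in the domain. -/
def image (U : Opens M.space) : Opens (EuclideanSpace ℝ (Fin p)) :=
  ⟨φ.toHomeo.target ∩ φ.toHomeo.symm ⁻¹' U, φ.toHomeo.isOpen_inter_preimage_symm U.isOpen⟩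

theorem image_le (U : Opens M.space) : φ.image U ≤ φ.target := fun _ h => h.1

theorem preimage_image_le (U : Opens M.space) : M.preimage φ.toHomeo (φ.image U) ≤ U := by
  rintro x ⟨hx, -, h⟩
  change φ.toHomeo.symm (φ.toHomeo x) ∈ U at h
  rwa [φ.toHomeo.left_inv hx] at h

theorem mem_image {U : Opens M.space} {x : M.space} (hx : x ∈ φ.toHomeo.source) (hU : x ∈ U) :
    φ.toHomeo x ∈ φ.image U := by
  refine ⟨φ.toHomeo.map_source hx, ?_⟩
  change φ.toHomeo.symm (φ.toHomeo x) ∈ U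
  rwa [φ.toHomeo.left_inv hx]

theorem restrict_sections_eq_iff {W : Opens (EuclideanSpace ℝ (Fin p))} (hW : W ≤ φ.target)
    (f g : FormalSeries (SmoothFunctions φ.target) η) :
    M.restrict (φ.preimage_le_domain hW) (φ.sections f) =
      M.restrict (φ.preimage_le_domain hW) (φ.sections g) ↔
    ∀ α, ∀ x : φ.target, x.1 ∈ W → f.coeff α x = g.coeff α x := by
  have h := φ.iso_restrict φ.target W subset_rfl hW
  change M.restrict (M.preimage_mono φ.toHomeo hW) (φ.iso φ.target _ f) =
    M.restrict (M.preimage_mono φ.toHomeo hW) (φ.iso φ.target _ g) ↔ _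
  rw [← h, ← h, (φ.iso W _).injective.eq_iff]
  constructor
  · intro h1 α x hx
    have := congrArg (fun k => k.coeff α ⟨x, hx⟩) h1
    exact this
  · intro h1
    ext α _ x
    exact h1 α ⟨x, hW x.2⟩ x.2

/-- The sections that vanish at `y` to order `k` in the formal variables. -/
noncomputable def vanishing (y : φ.domain) (k : ℕ) : AddSubgroup (M.Sections φ.domain) where
  carrier := {s | ∀ α : Fin N →₀ ℕ, α.degree < k →
    SmoothFunctions.eval (φ.toTarget y) ((φ.sections.symm s).coeff α) = 0}
  add_mem' hs ht α hα := by
    rw [map_add, FormalSeries.coeff_add, map_add, hs α hα, ht α hα, add_zero]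
  zero_mem' α _ := by rw [map_zero, FormalSeries.coeff_zero, map_zero]
  neg_mem' {s} hs α hα := by
    have : (φ.sections.symm (-s)).coeff α = - (φ.sections.symm s).coeff α := by
      rw [map_neg]; rfl
    rw [this, map_neg, hs α hα, neg_zero]

theorem mem_vanishing_zero (y : φ.domain) (s : M.Sections φ.domain) : s ∈ φ.vanishing y 0 :=
  fun _ h => absurd h (Nat.not_lt_zero _)

/-- The vanishing order depends only on the germ at `y`. This is needed because Hadamard's expansion
is valid only near `y`. -/
theorem mem_vanishing_of_locally_eq {y : φ.domain} {k : ℕ} {s t : M.Sections φ.domain}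
    {U : Opens M.space} (hU : U ≤ φ.domain) (hy : y.1 ∈ U) (hst : M.restrict hU s = M.restrict hU t)
    (hs : s ∈ φ.vanishing y k) : t ∈ φ.vanishing y k := by
  intro α hα
  rw [← hs α hα, SmoothFunctions.eval_apply, SmoothFunctions.eval_apply]
  have h1 := (φ.restrict_sections_eq_iff (φ.image_le U) (φ.sections.symm s)
    (φ.sections.symm t)).1 ?_ α (φ.toTarget y) (φ.mem_image y.2.1 hy)
  · exact h1.symm
  · have := congrArg (M.restrict (φ.preimage_image_le U)) hst
    rw [restrict_restrict, restrict_restrict] at this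
    rwa [AlgEquiv.apply_symm_apply, AlgEquiv.apply_symm_apply]

/-- The coefficient at `α` is evaluated at each point using order `|α| + 1`. Since the points vary
over `W`, no vanishing of derivatives along the body is required. -/
theorem eq_zero_of_forall_mem_vanishing {s : M.Sections φ.domain}
    {W : Opens (EuclideanSpace ℝ (Fin p))} (hW : W ≤ φ.target)
    (h : ∀ y : φ.domain, φ.toHomeo y.1 ∈ W → ∀ k, s ∈ φ.vanishing y k) :
    M.restrict (φ.preimage_le_domain hW) s = 0 := by
  have := (φ.restrict_sections_eq_iff hW (φ.sections.symm s) 0).2 ?_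
  · rwa [AlgEquiv.apply_symm_apply, map_zero, map_zero] at this
  · intro α x hx
    have hsymm : φ.toHomeo.symm x.1 ∈ φ.toHomeo.source := φ.toHomeo.map_target x.2
    have hx' : φ.toHomeo (φ.toHomeo.symm x.1) = x.1 := φ.toHomeo.right_inv x.2
    have h1 := h ⟨φ.toHomeo.symm x.1, φ.mem_domain.2 hsymm⟩ (hx'.symm ▸ hx) (α.degree + 1) α
      (Nat.lt_succ_self _)
    have h2 : φ.toTarget ⟨φ.toHomeo.symm x.1, φ.mem_domain.2 hsymm⟩ = x := Subtype.ext hx'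
    rw [h2] at h1
    exact h1

/-! #### Coordinates -/

/-- The coordinate sections over the domain. -/
noncomputable def coordinate : Fin p ⊕ Fin N → M.Sections φ.domain
  | .inl i => φ.sections (.const (SmoothFunctions.coord _ i))
  | .inr A => φ.sections (.var A)

/-- The degrees of the coordinates. -/
def coordinateDegree (_ : M.Chart p η) : Fin p ⊕ Fin N → Z2n n
  | .inl _ => 0
  | .inr A => η A

theorem coordinate_mem_homog (I : Fin p ⊕ Fin N) :
    φ.coordinate I ∈ M.homog _ (φ.coordinateDegree I) := by
  cases I with
  | inl i => exact φ.iso_homog _ _ _ _ (FormalSeries.isHomogeneous_const _)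
  | inr A => exact φ.iso_homog _ _ _ _ (FormalSeries.isHomogeneous_var _)

/-- The values of the coordinates at a point. -/
def coordinateValue (y : φ.domain) : Fin p ⊕ Fin N → ℝ
  | .inl i => φ.toHomeo y.1 i
  | .inr _ => 0

theorem algebraMap_coordinateValue_mem_homog (y : φ.domain) (I : Fin p ⊕ Fin N)
    (U : Opens M.space) :
    algebraMap ℝ (M.Sections U) (φ.coordinateValue y I) ∈ M.homog U (φ.coordinateDegree I) := by
  cases I with
  | inl i =>
    rw [Algebra.algebraMap_eq_smul_one]
    exact Submodule.smul_mem _ _ one_mem_homog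
  | inr A =>
    change algebraMap ℝ _ 0 ∈ _
    rw [map_zero]
    exact zero_mem _

theorem algebraMap_eq_sections (c : ℝ) : algebraMap ℝ (M.Sections φ.domain) c =
    φ.sections (.const (algebraMap ℝ _ c)) := by
  rw [Algebra.algebraMap_eq_smul_one, ← map_one φ.sections, ← map_smul]
  congr 1
  classical
  ext α _
  rw [FormalSeries.coeff_smul, FormalSeries.coeff_one, FormalSeries.coeff_const,
    Algebra.algebraMap_eq_smul_one]
  split_ifs <;> simp

/-- The translates of the coordinates that vanish at `y`. -/
noncomputable def centered (y : φ.domain) (I : Fin p ⊕ Fin N) : M.Sections φ.domain :=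
  φ.coordinate I - algebraMap ℝ _ (φ.coordinateValue y I)

theorem centered_inl (y : φ.domain) (i : Fin p) : φ.centered y (.inl i) =
    φ.sections (.const (SmoothFunctions.coord _ i - algebraMap ℝ _ (φ.toHomeo y.1 i))) := by
  rw [centered, FormalSeries.const_sub, map_sub, ← algebraMap_eq_sections]; rfl

theorem centered_inr (y : φ.domain) (A : Fin N) : φ.centered y (.inr A) =
    φ.sections (.var A) := by
  rw [centered]
  change _ - algebraMap ℝ _ 0 = _
  rw [map_zero, sub_zero]; rfl

/-- A factor `x_i - y_i` kills every coefficient at `y`, whatever the order; a factor `ξ_A` raises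
the order by one. -/
theorem centered_mul_mem_vanishing (y : φ.domain) (I : Fin p ⊕ Fin N) {k : ℕ}
    {s : M.Sections φ.domain} (hs : s ∈ φ.vanishing y k) :
    φ.centered y I * s ∈ φ.vanishing y (k + 1) := by
  intro α hα
  cases I with
  | inl i =>
    rw [centered_inl, map_mul, AlgEquiv.symm_apply_apply, FormalSeries.coeff_const_mul, map_mul,
      map_sub, SmoothFunctions.eval_apply, SmoothFunctions.coord_apply]
    have : SmoothFunctions.eval (φ.toTarget y) (algebraMap ℝ _ (φ.toHomeo y.1 i)) =
      φ.toHomeo y.1 i := rfl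
    rw [this]
    change (φ.toHomeo y.1 i - φ.toHomeo y.1 i) * _ = 0
    rw [sub_self, zero_mul]
  | inr A =>
    rw [centered_inr, map_mul, AlgEquiv.symm_apply_apply]
    exact FormalSeries.coeff_var_mul_vanishes _ A hs hα

/-- Hadamard's lemma for sections. -/
theorem exists_eq_sum_centered_mul (s : M.Sections φ.domain) (y : φ.domain) :
    ∃ (c : ℝ) (g : Fin p ⊕ Fin N → M.Sections φ.domain) (U : Opens M.space) (hU : U ≤ φ.domain),
      y.1 ∈ U ∧ M.restrict hU s =
        M.restrict hU (algebraMap ℝ _ c + ∑ I, φ.centered y I * g I) := by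
  -- The formal variables are split off algebraically. Only the constant coefficient, an ordinary
  -- smooth function, needs the analytic Hadamard lemma.
  obtain ⟨g, hg⟩ := (φ.sections.symm s).exists_eq_sum_var_mul
  set f := (φ.sections.symm s).coeff 0 with hf
  obtain ⟨h, W, hyW, hW, hfh⟩ := f.exists_hadamard (φ.toTarget y)
  refine ⟨f (φ.toTarget y), Sum.elim (fun i => φ.sections (.const (h i))) (fun A => φ.sections (g A)),
    M.preimage φ.toHomeo W, φ.preimage_le_domain hW, ⟨y.2.1, hyW⟩, ?_⟩
  have h1 : algebraMap ℝ (M.Sections φ.domain) (f (φ.toTarget y)) + ∑ I, φ.centered y I *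
      (Sum.elim (fun i => φ.sections (.const (h i))) (fun A => φ.sections (g A)) I :
        M.Sections φ.domain) =
      φ.sections (.const (algebraMap ℝ _ (f (φ.toTarget y))) +
        (∑ i, .const (SmoothFunctions.coord _ i - algebraMap ℝ _ (φ.toHomeo y.1 i)) * .const (h i)
          + ∑ A, .var A * g A)) := by
    rw [Fintype.sum_sum_type, map_add, map_add, map_sum, map_sum, algebraMap_eq_sections]
    simp only [centered_inl, centered_inr, Sum.elim_inl, Sum.elim_inr, map_mul]
  rw [h1]
  conv_lhs => rw [← φ.sections.apply_symm_apply s, hg]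
  rw [φ.restrict_sections_eq_iff hW]
  intro α x hx
  rw [FormalSeries.coeff_add, FormalSeries.coeff_add, FormalSeries.coeff_add, ← add_assoc]
  refine congrArg (· + (∑ A, FormalSeries.var A * g A).coeff α x) ?_
  rw [FormalSeries.coeff_sum]
  simp only [FormalSeries.coeff_const_mul, FormalSeries.coeff_const]
  by_cases hα : α = 0
  · simp only [hα, if_true]
    rw [hfh x hx]
    refine congrArg (f (φ.toTarget y) + ·) ?_
    exact (map_sum (SmoothFunctions.eval x) (fun i => (SmoothFunctions.coord φ.target i -
      algebraMap ℝ (SmoothFunctions φ.target) (φ.toHomeo y.1 i)) * h i) Finset.univ).symm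
  · simp only [hα, if_false, mul_zero, Finset.sum_const_zero]
    exact (add_zero (0 : ℝ)).symm

/-- The coordinate derivations over the domain. -/
noncomputable def coordinateDerivation :
    Fin p ⊕ Fin N → M.Sections φ.domain →ₗ[ℝ] M.Sections φ.domain
  | .inl i => φ.sections.toLinearMap ∘ₗ FormalSeries.mapLinear (SmoothFunctions.pderiv i) ∘ₗ
      φ.sections.symm.toLinearMap
  | .inr A => φ.sections.toLinearMap ∘ₗ FormalSeries.varDeriv A ∘ₗ φ.sections.symm.toLinearMap

theorem coordinateDerivation_inl (i : Fin p) (s : M.Sections φ.domain) :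
    φ.coordinateDerivation (.inl i) s =
      φ.sections (FormalSeries.mapLinear (SmoothFunctions.pderiv i) (φ.sections.symm s)) := rfl

theorem coordinateDerivation_inr (A : Fin N) (s : M.Sections φ.domain) :
    φ.coordinateDerivation (.inr A) s =
      φ.sections (FormalSeries.varDeriv A (φ.sections.symm s)) := rfl

theorem coordinateDerivation_mem_homog (I : Fin p ⊕ Fin N) {a : Z2n n} {s : M.Sections φ.domain}
    (hs : s ∈ M.homog _ a) : φ.coordinateDerivation I s ∈ M.homog _ (φ.coordinateDegree I + a) := by
  have h := φ.isHomogeneous_sections_symm hs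
  cases I with
  | inl i =>
    change _ ∈ M.homog _ (0 + a)
    rw [zero_add]
    exact φ.iso_homog _ _ _ _ (h.mapLinear _)
  | inr A => exact φ.iso_homog _ _ _ _ (h.varDeriv A)

theorem coordinateDerivation_mul (I : Fin p ⊕ Fin N) {a : Z2n n} {s : M.Sections φ.domain}
    (hs : s ∈ M.homog _ a) (t : M.Sections φ.domain) :
    φ.coordinateDerivation I (s * t) = φ.coordinateDerivation I s * t +
      koszulSign (φ.coordinateDegree I) a • (s * φ.coordinateDerivation I t) := by
  have h := φ.isHomogeneous_sections_symm hs
  cases I with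
  | inl i =>
    change _ = _ + koszulSign 0 a • _
    rw [koszulSign_zero_left, one_smul, coordinateDerivation_inl, coordinateDerivation_inl,
      coordinateDerivation_inl, map_mul,
      FormalSeries.mapLinear_mul (SmoothFunctions.pderiv_mul i), map_add, map_mul, map_mul,
      AlgEquiv.apply_symm_apply, AlgEquiv.apply_symm_apply]
  | inr A =>
    change _ = _ + koszulSign (η A) a • _
    rw [coordinateDerivation_inr, coordinateDerivation_inr,
      coordinateDerivation_inr, map_mul, FormalSeries.varDeriv_mul A h, map_add, map_zsmul, map_mul,
      map_mul, AlgEquiv.apply_symm_apply, AlgEquiv.apply_symm_apply]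

theorem coordinateDerivation_coordinate (I J : Fin p ⊕ Fin N) :
    φ.coordinateDerivation I (φ.coordinate J) = if I = J then 1 else 0 := by
  have hone : ∀ i : Fin p, SmoothFunctions.pderiv i (1 : SmoothFunctions φ.target) = 0 := by
    intro i
    have := SmoothFunctions.pderiv_mul i (1 : SmoothFunctions φ.target) 1
    rw [mul_one, mul_one, one_mul] at this
    exact left_eq_add.1 this
  cases I with
  | inl i =>
    cases J with
    | inl j =>
      rw [coordinateDerivation_inl, coordinate, AlgEquiv.symm_apply_apply,
        FormalSeries.mapLinear_const, SmoothFunctions.pderiv_coord]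
      by_cases h : i = j
      · rw [if_pos h, if_pos (congrArg _ h), FormalSeries.const_one, map_one]
      · rw [if_neg h, if_neg fun h' => h (Sum.inl_injective h')]
        have : (FormalSeries.const 0 : FormalSeries (SmoothFunctions φ.target) η) = 0 := by
          ext α _
          rw [FormalSeries.coeff_const, FormalSeries.coeff_zero, ite_self]
        rw [this, map_zero]
    | inr B =>
      rw [coordinateDerivation_inl, coordinate, AlgEquiv.symm_apply_apply,
        FormalSeries.mapLinear_var (hone i), map_zero, if_neg Sum.inl_ne_inr]
  | inr A =>
    cases J with
    | inl j =>
      rw [coordinateDerivation_inr, coordinate, AlgEquiv.symm_apply_apply,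
        FormalSeries.varDeriv_const, map_zero, if_neg Sum.inr_ne_inl]
    | inr B =>
      rw [coordinateDerivation_inr, coordinate, AlgEquiv.symm_apply_apply,
        FormalSeries.varDeriv_var]
      by_cases h : A = B
      · rw [if_pos h, if_pos (congrArg _ h), map_one]
      · rw [if_neg h, if_neg fun h' => h (Sum.inr_injective h'), map_zero]

end Chart

end Z2nRingedSpace

namespace Z2nManifold

open Z2nRingedSpace

variable {n : ℕ} {M : Z2nManifold.{u} n}

/-! ### Cut-off functions and extensions -/

/-- Every neighbourhood of a point carries a cut-off function of degree zero. -/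
theorem exists_cutoff {U : Opens M.space} {x : M.space} (hx : x ∈ U) :
    ∃ (ρ : M.Functions) (W C : Opens M.space), ρ ∈ M.HomogFunctions 0 ∧ x ∈ W ∧ W ≤ U ∧
      M.res W ρ = 1 ∧ (∀ z, z ∈ U ∨ z ∈ C) ∧ M.res C ρ = 0 := by
  obtain ⟨φ, hxφ⟩ := M.exists_chart x
  have := M.t2
  set V' := φ.image U with hV'
  obtain ⟨χ, K, W, hK, hKV, hxW, hWV, h1, h0⟩ :=
    SmoothFunctions.exists_bump (V := V') ⟨φ.toHomeo x, φ.mem_image hxφ hx⟩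
  have hcont : ContinuousOn φ.toHomeo.symm K :=
    φ.toHomeo.symm.continuousOn.mono fun z hz => (hKV hz).1
  -- The image of the compact set `K` is closed because the space is Hausdorff, so its complement is
  -- open and covers everything outside `V`.
  let C : Opens M.space :=
    ⟨(φ.toHomeo.symm '' K)ᶜ, (hK.image_of_continuousOn hcont).isClosed.isOpen_compl⟩
  let V : Opens M.space := M.preimage φ.toHomeo V'
  have hVU : V ≤ U := φ.preimage_image_le U
  have hV : (V' : Set _) ⊆ φ.toHomeo.target := φ.image_le U
  have hVC : ∀ z, z ∈ V ∨ z ∈ C := by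
    intro z
    by_cases hz : z ∈ C
    · exact .inr hz
    · obtain ⟨k, hk, rfl⟩ := not_not.1 hz
      refine .inl ⟨φ.toHomeo.map_target (hV (hKV hk)), ?_⟩
      change φ.toHomeo (φ.toHomeo.symm k) ∈ V'
      rw [φ.toHomeo.right_inv (hV (hKV hk))]
      exact hKV hk
  have hzero : ∀ W' : Opens (EuclideanSpace ℝ (Fin _)), ∀ h : W' ≤ V', ∀ c : ℝ,
      (∀ z : V', z.1 ∈ W' → χ z = c) →
      M.restrict (M.preimage_mono φ.toHomeo h) (φ.iso V' hV (.const χ)) = algebraMap ℝ _ c := by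
    intro W' h c hc
    rw [← φ.iso_restrict V' W' hV h, FormalSeries.map_const]
    have h2 : SmoothFunctions.restrict h χ = algebraMap ℝ _ c := by
      ext z
      exact hc ⟨z, h z.2⟩ z.2
    have h3 : (FormalSeries.const (algebraMap ℝ (SmoothFunctions W') c) :
        FormalSeries (SmoothFunctions W') M.formalDegree) = algebraMap ℝ _ c := by
      classical
      rw [Algebra.algebraMap_eq_smul_one (A := FormalSeries (SmoothFunctions W') M.formalDegree)]
      ext α _
      rw [FormalSeries.coeff_smul, FormalSeries.coeff_one, FormalSeries.coeff_const,
        Algebra.algebraMap_eq_smul_one]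
      split_ifs <;> simp
    rw [h2, h3, AlgEquiv.commutes]
  obtain ⟨ρ, hρV, hρC⟩ := exists_glue_pair hVC (φ.iso V' hV (.const χ)) 0 (by
    -- Points of the overlap are mapped outside `K`, where `χ` is zero. Hence the section defined by
    -- `χ` glues with zero.
    let W' : Opens (EuclideanSpace ℝ (Fin M.dimBody)) := V' ⊓ ⟨Kᶜ, hK.isClosed.isOpen_compl⟩
    have hW' : V ⊓ C ≤ M.preimage φ.toHomeo W' := by
      rintro z ⟨hz1, hz2⟩
      refine ⟨hz1.1, hz1.2, fun hz3 => hz2 ⟨_, hz3, ?_⟩⟩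
      exact φ.toHomeo.left_inv hz1.1
    have h2 := hzero W' inf_le_left 0 fun z hz => h0 z hz.2
    have := congrArg (M.restrict hW') h2
    rw [restrict_restrict, map_zero, map_zero] at this
    rw [map_zero]
    exact this)
  refine ⟨ρ, M.preimage φ.toHomeo W, C, ?_, ⟨hxφ, hxW⟩, (M.preimage_mono φ.toHomeo hWV).trans hVU,
    ?_, fun z => (hVC z).imp (fun h => hVU h) id, hρC⟩
  · refine function_mem_homog_of_locally fun z => ?_
    rcases hVC z with hz | hz
    · refine ⟨V, hz, ?_⟩
      rw [hρV]
      exact φ.iso_homog _ _ _ _ (FormalSeries.isHomogeneous_const _)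
    · refine ⟨C, hz, ?_⟩
      rw [hρC]
      exact zero_mem _
  · have h2 := hzero W hWV 1 fun z hz => h1 z hz
    rw [← hρV, restrict_res, map_one] at h2
    exact h2

/-- Sections over a neighbourhood of a point can be cut off to global functions. -/
theorem exists_cutoff_extension {U : Opens M.space} {x : M.space} (hx : x ∈ U) :
    ∃ (ρ : M.Functions) (W C : Opens M.space) (T : M.Sections U →ₗ[ℝ] M.Functions),
      ρ ∈ M.HomogFunctions 0 ∧ x ∈ W ∧ W ≤ U ∧ M.res W ρ = 1 ∧ (∀ z, z ∈ U ∨ z ∈ C) ∧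
      (∀ s, M.res U (T s) = M.res U ρ * s) ∧ (∀ s, M.res C (T s) = 0) := by
  obtain ⟨ρ, W, C, hρ, hxW, hWU, h1, hUC, h0⟩ := exists_cutoff hx
  have key : ∀ s : M.Sections U, ∃ f : M.Functions, M.res U f = M.res U ρ * s ∧ M.res C f = 0 := by
    intro s
    refine exists_glue_pair hUC _ _ ?_
    rw [map_mul, map_zero, restrict_res, res_eq_of_le inf_le_right (h0.trans (map_zero _).symm),
      map_zero, zero_mul]
  choose T hTU hTC using key
  refine ⟨ρ, W, C, ⟨⟨T, fun s t => ?_⟩, fun r s => ?_⟩, hρ, hxW, hWU, h1, hUC, hTU, hTC⟩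
  · refine function_ext_pair hUC ?_ ?_
    · rw [map_add, hTU, hTU, hTU, mul_add]
    · rw [map_add, hTC, hTC, hTC, add_zero]
  · refine function_ext_pair hUC ?_ ?_
    · rw [RingHom.id_apply, map_smul, hTU, hTU, mul_smul_comm]
    · rw [RingHom.id_apply, map_smul, hTC, hTC, smul_zero]

theorem mem_homog_of_cutoff {U C : Opens M.space} {ρ : M.Functions} (hρ : ρ ∈ M.HomogFunctions 0)
    (hUC : ∀ z, z ∈ U ∨ z ∈ C) {a : Z2n n} {s : M.Sections U} (hs : s ∈ M.homog U a)
    {f : M.Functions} (hU : M.res U f = M.res U ρ * s) (hC : M.res C f = 0) :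
    f ∈ M.HomogFunctions a := by
  refine function_mem_homog_of_locally fun z => ?_
  rcases hUC z with hz | hz
  · refine ⟨U, hz, ?_⟩
    rw [hU]
    simpa using mul_mem_homog (res_mem U hρ) hs
  · refine ⟨C, hz, ?_⟩
    rw [hC]
    exact zero_mem _

/-- A finite family of sections agrees near every point with global functions. -/
theorem exists_extension_family {ι : Type*} [Finite ι] {U : Opens M.space} {x : M.space}
    (hx : x ∈ U) (s : ι → M.Sections U) :
    ∃ (f : ι → M.Functions) (W : Opens M.space) (hW : W ≤ U), x ∈ W ∧
      (∀ i, M.res W (f i) = M.restrict hW (s i)) ∧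
      ∀ i a, s i ∈ M.homog U a → f i ∈ M.HomogFunctions a := by
  obtain ⟨ρ, W, C, T, hρ, hxW, hWU, h1, hUC, hU, hC⟩ := exists_cutoff_extension hx
  refine ⟨fun i => T (s i), W, hWU, hxW, fun i => ?_,
    fun i a ha => mem_homog_of_cutoff hρ hUC ha (hU _) (hC _)⟩
  rw [← restrict_res hWU, hU, map_mul, restrict_res, h1, one_mul]

/-! ### Locality of derivations -/

/-- For a cut-off `ρ` supported in `V`, the product `ρ f` vanishes globally. The Leibniz rule gives
`0 = D(ρ) f + ρ D(f)`, and near the point `f = 0` and `ρ = 1`. -/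
theorem IsHomogDerivation.res_eq_zero {d : Z2n n} {D : M.Functions →ₗ[ℝ] M.Functions}
    (hD : M.IsHomogDerivation d D) {V : Opens M.space} {f : M.Functions} (hf : M.res V f = 0) :
    M.res V (D f) = 0 := by
  rw [← map_zero (M.res V)]
  refine res_ext fun x hx => ?_
  obtain ⟨ρ, W, C, hρ, hxW, hWV, h1, hVC, h0⟩ := exists_cutoff hx
  refine ⟨W, hxW, ?_⟩
  have h2 : ρ * f = 0 := function_ext_pair hVC (by rw [map_mul, hf, mul_zero, map_zero])
    (by rw [map_mul, h0, zero_mul, map_zero])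
  have h3 := hD.leibniz 0 ρ hρ f
  rw [h2, map_zero, koszulSign_zero_right, one_smul] at h3
  have h4 := congrArg (M.res W) h3
  rw [map_add, map_mul, map_mul, h1, one_mul,
    res_eq_of_le hWV (hf.trans (map_zero _).symm), map_zero, mul_zero, zero_add] at h4
  rw [map_zero]
  exact h4.symm

theorem IsHomogDerivation.res_congr {d : Z2n n} {D : M.Functions →ₗ[ℝ] M.Functions}
    (hD : M.IsHomogDerivation d D) {V : Opens M.space} {f f' : M.Functions}
    (hf : M.res V f = M.res V f') : M.res V (D f) = M.res V (D f') := by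
  rw [← sub_eq_zero, ← map_sub, ← map_sub]
  exact hD.res_eq_zero (by rw [map_sub, hf, sub_self])

theorem IsHomogDerivation.map_one {d : Z2n n} {D : M.Functions →ₗ[ℝ] M.Functions}
    (hD : M.IsHomogDerivation d D) : D 1 = 0 := by
  have := hD.leibniz 0 1 one_mem_homog 1
  rw [koszulSign_zero_right, one_smul, mul_one, mul_one, one_mul] at this
  exact left_eq_add.1 this

theorem IsHomogDerivation.map_algebraMap {d : Z2n n} {D : M.Functions →ₗ[ℝ] M.Functions}
    (hD : M.IsHomogDerivation d D) (c : ℝ) : D (algebraMap ℝ _ c) = 0 := by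
  rw [Algebra.algebraMap_eq_smul_one, map_smul, hD.map_one, smul_zero]

/-- The cut-off argument for locality again, for derivations defined only on the sections over `U`,
such as the coordinate derivations. -/
theorem restrict_derivation_eq_zero {d : Z2n n} {U : Opens M.space}
    {D : M.Sections U →ₗ[ℝ] M.Sections U} (hmul : ∀ a, ∀ s ∈ M.homog U a, ∀ t,
      D (s * t) = D s * t + koszulSign d a • (s * D t)) {V : Opens M.space} (hV : V ≤ U)
    {s : M.Sections U} (hs : M.restrict hV s = 0) : M.restrict hV (D s) = 0 := by
  refine section_ext fun x hx => ?_
  obtain ⟨ρ, W, C, hρ, hxW, hWV, h1, hVC, h0⟩ := exists_cutoff hx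
  refine ⟨W, hWV, hxW, ?_⟩
  have h2 : M.res U ρ * s = 0 := by
    refine section_ext fun z hz => ?_
    rcases hVC z with h | h
    · exact ⟨V, hV, h, by rw [map_mul, hs, mul_zero, map_zero]⟩
    · refine ⟨C ⊓ U, inf_le_right, ⟨h, hz⟩, ?_⟩
      rw [map_mul, restrict_res, res_eq_of_le inf_le_left (h0.trans (map_zero _).symm), map_zero,
        zero_mul, map_zero]
  have h3 := hmul 0 _ (res_mem U hρ) s
  rw [h2, map_zero, koszulSign_zero_right, one_smul] at h3
  have h4 := congrArg (M.restrict (hWV.trans hV)) h3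
  rw [map_add, map_mul, map_mul, restrict_res, h1, one_mul, ← restrict_restrict hV hWV s, hs,
    map_zero, map_zero, mul_zero, zero_add] at h4
  rw [restrict_restrict, map_zero]
  exact h4.symm

/-- A derivation of the sections over `U` agrees near every point with a derivation of the
functions. -/
theorem exists_derivation_extension {ι : Type*} {U : Opens M.space} {x : M.space} (hx : x ∈ U)
    (d : ι → Z2n n) (D : ι → M.Sections U →ₗ[ℝ] M.Sections U)
    (hdeg : ∀ i a, ∀ s ∈ M.homog U a, D i s ∈ M.homog U (d i + a))
    (hmul : ∀ i a, ∀ s ∈ M.homog U a, ∀ t,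
      D i (s * t) = D i s * t + koszulSign (d i) a • (s * D i t)) :
    ∃ (E : ι → M.Functions →ₗ[ℝ] M.Functions) (W : Opens M.space) (hW : W ≤ U), x ∈ W ∧
      (∀ i, M.IsHomogDerivation (d i) (E i)) ∧
      ∀ i f, M.res W (E i f) = M.restrict hW (D i (M.res U f)) := by
  obtain ⟨ρ, W, C, T, hρ, hxW, hWU, h1, hUC, hU, hC⟩ := exists_cutoff_extension hx
  -- The extension is `ρ D`. Since `ρ` has degree zero it commutes with everything, so the signs in
  -- the Leibniz rule are unaffected.
  refine ⟨fun i => T ∘ₗ D i ∘ₗ (M.res U).toLinearMap, W, hWU, hxW, fun i => ⟨?_, ?_⟩, ?_⟩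
  · intro a f hf
    exact mem_homog_of_cutoff hρ hUC (hdeg i a _ (res_mem U hf)) (hU _) (hC _)
  · intro a f hf h
    simp only [LinearMap.comp_apply, AlgHom.toLinearMap_apply]
    refine function_ext_pair hUC ?_ ?_
    · rw [hU, map_add, map_zsmul, map_mul (M.res U), map_mul (M.res U), map_mul (M.res U), hU, hU,
        hmul i a _ (res_mem U hf), mul_add, mul_assoc, mul_smul_comm, ← mul_assoc, ← mul_assoc,
        ← mul_assoc, commute_of_mem_zero (res_mem U hρ) (M.res U f)]
    · rw [hC, map_add, map_zsmul, map_mul, map_mul, hC, hC, zero_mul, mul_zero, smul_zero,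
        add_zero]
  · intro i f
    simp only [LinearMap.comp_apply, AlgHom.toLinearMap_apply]
    rw [← restrict_res hWU, hU, map_mul, restrict_res, h1, one_mul]

/-! ### Local frames -/

/-- Near every point there are functions and derivations of `C^∞(M)` that behave like coordinates
and coordinate derivations; a derivation that kills the coordinates vanishes. -/
theorem exists_local_coordinates (x : M.space) :
    ∃ (V : Opens M.space) (m : ℕ) (e : Fin m → Z2n n) (u : Fin m → M.Functions)
      (E : Fin m → M.Functions →ₗ[ℝ] M.Functions), x ∈ V ∧
      (∀ I, u I ∈ M.HomogFunctions (e I)) ∧ (∀ I, M.IsHomogDerivation (e I) (E I)) ∧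
      (∀ I J, M.res V (E I (u J)) = if I = J then 1 else 0) ∧
      ∀ d Z, M.IsHomogDerivation d Z → (∀ I, M.res V (Z (u I)) = 0) → ∀ f, M.res V (Z f) = 0 := by
  obtain ⟨φ, hxφ⟩ := M.exists_chart x
  have hx : x ∈ φ.domain := φ.mem_domain.2 hxφ
  obtain ⟨u, W₁, hW₁, hxW₁, hu, hudeg⟩ := exists_extension_family hx φ.coordinate
  obtain ⟨E, W₂, hW₂, hxW₂, hE, hEφ⟩ := exists_derivation_extension hx φ.coordinateDegree
    φ.coordinateDerivation (fun I a s hs => φ.coordinateDerivation_mem_homog I hs)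
    (fun I a s hs t => φ.coordinateDerivation_mul I hs t)
  -- `V` is taken as the preimage of an open subset of the chart's range, the form in which sections
  -- are compared coefficientwise.
  let V' := φ.image (W₁ ⊓ W₂)
  let V : Opens M.space := M.preimage φ.toHomeo V'
  have hV₁ : V ≤ W₁ := (φ.preimage_image_le _).trans inf_le_left
  have hV₂ : V ≤ W₂ := (φ.preimage_image_le _).trans inf_le_right
  have hVd : V ≤ φ.domain := hV₁.trans hW₁
  have huV : ∀ I, M.res V (u I) = M.restrict hVd (φ.coordinate I) := fun I => by
    rw [← restrict_res hV₁, hu, restrict_restrict]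
  let σ : Fin (M.dimBody + M.dimFormal) ≃ Fin M.dimBody ⊕ Fin M.dimFormal := finSumFinEquiv.symm
  refine ⟨V, M.dimBody + M.dimFormal, fun I => φ.coordinateDegree (σ I), fun I => u (σ I),
    fun I => E (σ I), ⟨hxφ, φ.mem_image hxφ ⟨hxW₁, hxW₂⟩⟩,
    fun I => hudeg _ _ (φ.coordinate_mem_homog _), fun I => hE _, fun I J => ?_, ?_⟩
  · have h1 : M.res V (E (σ I) (u (σ J))) =
        M.restrict hVd (φ.coordinateDerivation (σ I) (φ.coordinate (σ J))) := by
      rw [← restrict_res hV₂, hEφ, restrict_restrict, ← sub_eq_zero, ← map_sub, ← map_sub]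
      refine restrict_derivation_eq_zero (fun a s hs t => φ.coordinateDerivation_mul _ hs t) hVd ?_
      rw [map_sub, restrict_res, huV, sub_self]
    rw [h1, φ.coordinateDerivation_coordinate]
    by_cases h : I = J
    · rw [if_pos h, if_pos (congrArg _ h), _root_.map_one]
    · rw [if_neg h, if_neg fun h' => h (σ.injective h'), map_zero]
  · intro d Z hZ hZu f
    replace hZu : ∀ I, M.res V (Z (u I)) = 0 := fun I => by
      simpa using hZu (σ.symm I)
    -- Near `y` one has `f = c + ∑ v_I g_I` with `v_I` the coordinates centred at `y`. As `Z` kills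
    -- `c` and the `v_I`, it leaves `Z f = ∑ ± v_I Z(g_I)`. The induction hypothesis covers all
    -- functions, in particular the `g_I`, and each `v_I` raises the order.
    have key : ∀ y : φ.domain, y.1 ∈ V → ∀ k, ∀ f, M.res φ.domain (Z f) ∈ φ.vanishing y k := by
      intro y hy k
      induction k with
      | zero => exact fun f => φ.mem_vanishing_zero y _
      | succ k ih =>
        intro f
        obtain ⟨c, g, U, hU, hyU, hfg⟩ := φ.exists_eq_sum_centered_mul (M.res φ.domain f) y
        obtain ⟨g', W₃, hW₃, hyW₃, hg', -⟩ := exists_extension_family y.2 g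
        let v : Fin M.dimBody ⊕ Fin M.dimFormal → M.Functions := fun I =>
          u I - algebraMap ℝ _ (φ.coordinateValue y I)
        have hv : ∀ I, v I ∈ M.HomogFunctions (φ.coordinateDegree I) := fun I =>
          sub_mem (hudeg _ _ (φ.coordinate_mem_homog _))
            (φ.algebraMap_coordinateValue_mem_homog y I ⊤)
        have hvV : ∀ I, M.res V (v I) = M.restrict hVd (φ.centered y I) := fun I => by
          simp only [v, Chart.centered, map_sub, AlgHom.commutes, huV]
        have hZv : ∀ I, Z (v I) = Z (u I) := fun I => by
          simp only [v, map_sub, hZ.map_algebraMap, sub_zero]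
        let O : Opens M.space := V ⊓ U ⊓ W₃
        have hOV : O ≤ V := inf_le_left.trans inf_le_left
        have hOU : O ≤ U := inf_le_left.trans inf_le_right
        have hO₃ : O ≤ W₃ := inf_le_right
        have hyO : y.1 ∈ O := ⟨⟨hy, hyU⟩, hyW₃⟩
        have h1 : M.res O f = M.res O (algebraMap ℝ _ c + ∑ I, v I * g' I) := by
          have := congrArg (M.restrict hOU) hfg
          rw [restrict_restrict, restrict_restrict, restrict_res] at this
          rw [this]
          simp only [map_add, map_sum, map_mul, AlgHom.commutes]
          congr 1
          refine Finset.sum_congr rfl fun I _ => ?_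
          rw [← restrict_res hOV, hvV, restrict_restrict, ← restrict_res hO₃, hg', restrict_restrict]
        have h2 := hZ.res_congr h1
        rw [map_add, hZ.map_algebraMap, zero_add, map_sum] at h2
        have h3 : M.res O (Z f) = M.restrict (hOV.trans hVd) (∑ I, koszulSign d
            (φ.coordinateDegree I) • (φ.centered y I * M.res φ.domain (Z (g' I)))) := by
          rw [h2, map_sum, map_sum]
          refine Finset.sum_congr rfl fun I _ => ?_
          rw [hZ.leibniz _ _ (hv I), hZv, map_add, map_mul,
            res_eq_of_le hOV ((hZu I).trans (map_zero _).symm), map_zero, zero_mul, zero_add,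
            map_zsmul, map_zsmul, map_mul, map_mul, ← restrict_res hOV (v I), hvV,
            restrict_restrict, restrict_res]
        refine φ.mem_vanishing_of_locally_eq (hOV.trans hVd) hyO
          (h3.symm.trans (restrict_res _ _).symm) ?_
        exact AddSubgroup.sum_mem _ fun I _ => zsmul_mem
          (φ.centered_mul_mem_vanishing y I (ih (g' I))) _
    have := φ.eq_zero_of_forall_mem_vanishing (φ.image_le _) (W := V')
      (s := M.res φ.domain (Z f)) fun y hy k => key y ⟨y.2.1, hy⟩ k f
    rwa [restrict_res] at this

end Z2nManifold

namespace Z2nManifold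

open Z2nRingedSpace

variable {n : ℕ} {M : Z2nManifold.{u} n}

/-! ### Vector fields -/

theorem IsHomogDerivation.sub {d : Z2n n} {D D' : M.Functions →ₗ[ℝ] M.Functions}
    (hD : M.IsHomogDerivation d D) (hD' : M.IsHomogDerivation d D') :
    M.IsHomogDerivation d (D - D') where
  degree a f hf := Submodule.sub_mem _ (hD.degree a f hf) (hD'.degree a f hf)
  leibniz a f hf h := by
    simp only [LinearMap.sub_apply, hD.leibniz a f hf h, hD'.leibniz a f hf h, sub_mul, mul_sub,
      smul_sub]
    abel

theorem IsHomogDerivation.sum {d : Z2n n} {ι : Type*} {s : Finset ι}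
    {D : ι → M.Functions →ₗ[ℝ] M.Functions} (hD : ∀ i, M.IsHomogDerivation d (D i)) :
    M.IsHomogDerivation d (∑ i ∈ s, D i) := by
  classical
  induction s using Finset.induction_on with
  | empty => exact .zero M d
  | insert i s hi ih => rw [Finset.sum_insert hi]; exact (hD i).add ih

theorem IsHomogDerivation.mem_vect {d : Z2n n} {D : M.Functions →ₗ[ℝ] M.Functions}
    (hD : M.IsHomogDerivation d D) : D ∈ M.vect := by
  classical
  refine ⟨Pi.single d D, fun b => ?_, by simp⟩
  by_cases h : b = d
  · subst h
    rwa [Pi.single_eq_same]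
  · rw [Pi.single_eq_of_ne h]
    exact .zero M b

namespace Vect

theorem ext {X Y : M.Vect} (h : ∀ f, X.app f = Y.app f) : X = Y :=
  Subtype.ext (LinearMap.ext h)

theorem app_sub (X Y : M.Vect) (f : M.Functions) : (X - Y).app f = X.app f - Y.app f := rfl

theorem app_smul (k : M.Functions) (X : M.Vect) (f : M.Functions) :
    (k • X).app f = k * X.app f := rfl

theorem app_sum {ι : Type*} (s : Finset ι) (X : ι → M.Vect) (f : M.Functions) :
    (∑ i ∈ s, X i).app f = ∑ i ∈ s, (X i).app f := by
  simp [Vect.app]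

theorem exists_eq_sum (X : M.Vect) :
    ∃ c : Z2n n → M.Vect, (∀ d, (c d).IsHomog d) ∧ X = ∑ d, c d := by
  obtain ⟨c, hc, hX⟩ := X.2
  refine ⟨fun d => ⟨c d, (hc d).mem_vect⟩, hc, Vect.ext fun f => ?_⟩
  rw [app_sum, Vect.app, hX]
  simp [Vect.app]

theorem IsHomog.sub {X Y : M.Vect} {d : Z2n n} (hX : X.IsHomog d) (hY : Y.IsHomog d) :
    (X - Y).IsHomog d := IsHomogDerivation.sub hX hY

end Vect

/-- The components of `Z` can only be `Z(u_J)`, as evaluation on the coordinates shows. They work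
because, degree by degree, `Z - ∑ Z(u_J) E_J` is a homogeneous derivation that kills the coordinates
over `V`. -/
theorem exists_frame (x : M.space) : ∃ (V : Opens M.space) (m : ℕ) (E : Fin m → M.Vect)
    (e : Fin m → Z2n n), x ∈ V ∧ IsFrame V E e := by
  obtain ⟨V, m, e, u, E, hxV, hu, hE, hEu, hZ⟩ := exists_local_coordinates x
  refine ⟨V, m, fun I => ⟨E I, (hE I).mem_vect⟩, e, hxV, hE, fun Z => ?_⟩
  have huniq : ∀ c : Matrix (Fin 1) (Fin m) (M.Sections V),
      IsComponents V (fun I => (⟨E I, (hE I).mem_vect⟩ : M.Vect)) (fun _ => Z) c →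
      c = fun _ J => M.res V (Z.app (u J)) := by
    intro c hc
    ext i J
    rw [hc i (u J), Finset.sum_eq_single J]
    · change _ = _ * M.res V (E J (u J))
      rw [hEu, if_pos rfl, mul_one]
    · intro K _ hK
      change _ * M.res V (E K (u J)) = _
      rw [hEu, if_neg hK, mul_zero]
    · simp
  refine ⟨fun _ J => M.res V (Z.app (u J)), fun _ f => ?_, huniq⟩
  obtain ⟨Zd, hZd, rfl⟩ := Z.exists_eq_sum
  have key : ∀ d, M.res V ((Zd d).app f) =
      ∑ J, M.res V ((Zd d).app (u J)) * M.res V (E J f) := by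
    intro d
    have h1 : M.IsHomogDerivation d ((Zd d).1 - ∑ J, (Zd d).app (u J) • E J) := by
      refine IsHomogDerivation.sub (hZd d) (IsHomogDerivation.sum fun J => ?_)
      have := (hE J).smul ((hZd d).degree _ _ (hu J))
      rwa [add_assoc, Z2n.add_self, add_zero] at this
    have h2 := hZ d _ h1 (fun I => ?_) f
    · rw [LinearMap.sub_apply, map_sub, sub_eq_zero] at h2
      change M.res V ((Zd d).1 f) = _
      rw [h2, LinearMap.sum_apply, map_sum]
      exact Finset.sum_congr rfl fun J _ => map_mul (M.res V) _ _
    · rw [LinearMap.sub_apply, map_sub, sub_eq_zero, LinearMap.sum_apply, map_sum,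
        Finset.sum_eq_single I]
      · rw [LinearMap.smul_apply, smul_eq_mul, map_mul, hEu, if_pos rfl, mul_one]
        rfl
      · intro J _ hJ
        rw [LinearMap.smul_apply, smul_eq_mul, map_mul, hEu, if_neg hJ, mul_zero]
      · simp
  simp only [Vect.app_sum, map_sum, key, Finset.sum_mul]
  rw [Finset.sum_comm]
  rfl

theorem IsFrame.exists_components {V : Opens M.space} {m : ℕ} {E : Fin m → M.Vect}
    {e : Fin m → Z2n n} (hE : IsFrame V E e) {k : ℕ} (Z : Fin k → M.Vect) :
    ∃ c : Matrix (Fin k) (Fin m) (M.Sections V), IsComponents V E Z c := by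
  choose c hc using fun I => (hE.existsUnique_components (Z I)).exists
  exact ⟨fun I J => c I 0 J, fun I f => hc I 0 f⟩

/-- The vector field vanishes over `V`. -/
def Vect.VanishesOn (X : M.Vect) (V : Opens M.space) : Prop := ∀ f, M.res V (X.app f) = 0

theorem Vect.VanishesOn.eq_zero {X : M.Vect} (h : X.VanishesOn ⊤) : X = 0 :=
  Vect.ext fun f => by
    have h0 : (0 : M.Vect).app f = 0 := rfl
    rw [h0]
    exact (restrict_self (X.app f)).symm.trans (h f)

/-! ### Locality and non-degeneracy of the metric -/

namespace RiemannianMetric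

variable (g : RiemannianMetric M)

/-- The pairing as an additive map of its first argument. -/
def pairingLeft (Y : M.Vect) : M.Vect →+ M.Functions :=
  AddMonoidHom.mk' (fun X => g.pairing X Y) fun X X' => g.add_left X X' Y

/-- The pairing as an additive map of its second argument. -/
def pairingRight (X : M.Vect) : M.Vect →+ M.Functions :=
  AddMonoidHom.mk' (fun Y => g.pairing X Y) fun Y Y' => g.add_right X Y Y'

theorem zero_left (Y : M.Vect) : g.pairing 0 Y = 0 := map_zero (g.pairingLeft Y)

theorem sub_left (X X' Y : M.Vect) : g.pairing (X - X') Y = g.pairing X Y - g.pairing X' Y :=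
  map_sub (g.pairingLeft Y) X X'

theorem sub_right (X Y Y' : M.Vect) : g.pairing X (Y - Y') = g.pairing X Y - g.pairing X Y' :=
  map_sub (g.pairingRight X) Y Y'

theorem sum_left {ι : Type*} (s : Finset ι) (X : ι → M.Vect) (Y : M.Vect) :
    g.pairing (∑ i ∈ s, X i) Y = ∑ i ∈ s, g.pairing (X i) Y := map_sum (g.pairingLeft Y) X s

theorem sum_right {ι : Type*} (s : Finset ι) (X : M.Vect) (Y : ι → M.Vect) :
    g.pairing X (∑ i ∈ s, Y i) = ∑ i ∈ s, g.pairing X (Y i) := map_sum (g.pairingRight X) Y s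

variable {g} {V : Opens M.space}

/-- Multiplying `X` by a cut-off gives the zero field, and the pairing is linear over functions in
its first argument. -/
theorem res_pairing_eq_zero {X : M.Vect} (hX : X.VanishesOn V) (Y : M.Vect) :
    M.res V (g.pairing X Y) = 0 := by
  rw [← map_zero (M.res V)]
  refine res_ext fun x hx => ?_
  obtain ⟨ρ, W, C, hρ, hxW, hWV, h1, hVC, h0⟩ := exists_cutoff hx
  have h2 : ρ • X = 0 := Vect.ext fun f => by
    rw [Vect.app_smul]
    refine function_ext_pair hVC ?_ ?_
    · rw [map_mul, hX f, mul_zero]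
      exact (map_zero _).symm
    · rw [map_mul, h0, zero_mul]
      exact (map_zero _).symm
  have h3 := g.smul_left ρ X Y
  rw [h2, zero_left] at h3
  refine ⟨W, hxW, ?_⟩
  rw [h3, map_mul, h1, one_mul]

/-- Linearity over functions is available only on the left, so the arguments are exchanged by graded
symmetry; this is why `Y` is homogeneous. -/
theorem res_pairing_right_eq_zero {Y : M.Vect} {b : Z2n n} (hb : Y.IsHomog b)
    (hY : Y.VanishesOn V) (X : M.Vect) : M.res V (g.pairing X Y) = 0 := by
  obtain ⟨c, hc, rfl⟩ := X.exists_eq_sum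
  rw [sum_left, map_sum]
  refine Finset.sum_eq_zero fun a _ => ?_
  rw [g.symm a b _ _ (hc a) hb, map_zsmul, res_pairing_eq_zero hY, smul_zero]

/-- Components exist only over `V`, while the metric pairs global fields. Near each point the
components are replaced by global functions, and locality removes the difference. -/
theorem res_pairing_eq_sum {m : ℕ} {E : Fin m → M.Vect} {Z : M.Vect} {c : Fin m → M.Sections V}
    (hc : ∀ f, M.res V (Z.app f) = ∑ J, c J * M.res V ((E J).app f)) (Y : M.Vect) :
    M.res V (g.pairing Z Y) = ∑ J, c J * M.res V (g.pairing (E J) Y) := by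
  refine section_ext fun x hx => ?_
  obtain ⟨k, W, hW, hxW, hk, -⟩ := exists_extension_family hx c
  refine ⟨W, hW, hxW, ?_⟩
  have h1 : (Z - ∑ J, k J • E J).VanishesOn W := by
    intro f
    rw [Vect.app_sub, map_sub, sub_eq_zero, Vect.app_sum, ← restrict_res hW, hc, map_sum, map_sum]
    refine Finset.sum_congr rfl fun J _ => ?_
    rw [Vect.app_smul, map_mul, map_mul, hk, restrict_res]
  have h2 := res_pairing_eq_zero (g := g) h1 Y
  rw [sub_left, map_sub, sub_eq_zero, sum_left, map_sum] at h2
  rw [restrict_res, h2, map_sum]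
  refine Finset.sum_congr rfl fun J _ => ?_
  rw [g.smul_left, map_mul, map_mul, hk, restrict_res]

variable (g) in
/-- The matrix of the metric with respect to a family of vector fields. -/
def gram (V : Opens M.space) {m : ℕ} (E : Fin m → M.Vect) :
    Matrix (Fin m) (Fin m) (M.Sections V) :=
  Matrix.of fun I J => M.res V (g.pairing (E I) (E J))

theorem gram_apply {m : ℕ} (E : Fin m → M.Vect) (I J : Fin m) :
    g.gram V E I J = M.res V (g.pairing (E I) (E J)) := rfl

/-- In a frame, the components of `Y` are the pairings `⟨Y | E_I⟩` multiplied by the inverse matrix.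
-/
theorem vanishesOn_of_pairing_eq_zero {Y : M.Vect} {b : Z2n n} (hb : Y.IsHomog b)
    (hY : ∀ X, M.res V (g.pairing X Y) = 0) : Y.VanishesOn V := by
  intro f
  rw [← map_zero (M.res V)]
  refine res_ext fun x hx => ?_
  obtain ⟨U, m, E, e, hxU, hE⟩ := exists_frame x
  obtain ⟨c, hc⟩ := hE.exists_components fun _ : Fin 1 => Y
  obtain ⟨B, hB⟩ := (g.nondegenerate U m E e hE).exists_right_inv
  change g.gram U E * B = 1 at hB
  let O := U ⊓ V
  have hOU : O ≤ U := inf_le_left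
  have hOV : O ≤ V := inf_le_right
  have h1 : ∀ K, M.restrict hOU (c 0 K) = 0 := by
    intro K
    have h2 : c 0 K = ∑ I, M.res U (g.pairing Y (E I)) * B I K := by
      calc c 0 K = ∑ J, c 0 J * (g.gram U E * B) J K := by simp [hB, Matrix.one_apply]
        _ = ∑ I, (∑ J, c 0 J * g.gram U E J I) * B I K := by
          simp only [Matrix.mul_apply, Finset.mul_sum, Finset.sum_mul, mul_assoc]
          exact Finset.sum_comm
        _ = _ := Finset.sum_congr rfl fun I _ => by
          rw [res_pairing_eq_sum (hc 0)]; rfl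
    rw [h2, map_sum]
    refine Finset.sum_eq_zero fun I _ => ?_
    rw [map_mul, restrict_res, g.symm b (e I) _ _ hb (hE.homog I), map_zsmul,
      res_eq_of_le hOV ((hY (E I)).trans (map_zero _).symm), map_zero, smul_zero, zero_mul]
  refine ⟨O, ⟨hxU, hx⟩, ?_⟩
  rw [← restrict_res hOU, hc 0 f, map_sum, map_zero]
  exact Finset.sum_eq_zero fun J _ => by rw [map_mul, h1, zero_mul]

/-- Pairing a homogeneous field with the components of `Y` gives functions of distinct degrees, so
each vanishes separately and the homogeneous case applies. -/
theorem eq_zero_of_pairing_eq_zero {Y : M.Vect} (hY : ∀ X, g.pairing X Y = 0) : Y = 0 := by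
  obtain ⟨c, hc, rfl⟩ := Y.exists_eq_sum
  refine Finset.sum_eq_zero fun b _ => ?_
  refine (vanishesOn_of_pairing_eq_zero (g := g) (hc b) fun X => ?_).eq_zero
  suffices g.pairing X (c b) = 0 by rw [this, map_zero]
  obtain ⟨X', hX', rfl⟩ := X.exists_eq_sum
  rw [sum_left]
  refine Finset.sum_eq_zero fun a _ => ?_
  have h1 := congrArg (M.component ⊤ (a + b + g.deg)) (hY (X' a))
  rw [sum_right, map_sum, map_zero, Finset.sum_eq_single b] at h1
  · rwa [component_of_mem (g.homog a b _ _ (hX' a) (hc b))] at h1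
  · intro b' _ hb'
    exact component_of_mem_ne (g.homog a b' _ _ (hX' a) (hc b')) (by simpa using hb')
  · simp

/-! ### The inverse matrix -/

theorem gram_mem_homog {m : ℕ} {E : Fin m → M.Vect} {e : Fin m → Z2n n} (hE : IsFrame V E e)
    (I J : Fin m) : g.gram V E I J ∈ M.homog V (e I + e J + g.deg) :=
  res_mem V (g.homog _ _ _ _ (hE.homog I) (hE.homog J))

theorem gram_symm {m : ℕ} {E : Fin m → M.Vect} {e : Fin m → Z2n n} (hE : IsFrame V E e)
    (I J : Fin m) : g.gram V E I J = koszulSign (e I) (e J) • g.gram V E J I := by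
  rw [gram_apply, g.symm _ _ _ _ (hE.homog I) (hE.homog J), map_zsmul, gram_apply]

/-- On the left is the sign produced when an entry of the signed transpose times `g` is rearranged
into `g B`. On the right the summation index `j` has disappeared, so the sign can be pulled out of
the sum. -/
theorem inverse_sign {n : ℕ} (i j k c : Z2n n) :
    koszulSign k k * koszulSign j j * koszulSign j k * koszulSign c c *
      koszulSign (j + k + c) (j + i + c) * koszulSign j i =
    koszulSign k k * koszulSign k i * koszulSign k c * koszulSign c i := by
  simp only [koszulSign, ← paritySign_add, add_dotProduct, dotProduct_add]
  congr 1
  rw [dotProduct_comm c j, dotProduct_comm k j]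
  have h2 : (2 : ZMod 2) = 0 := rfl
  linear_combination (j ⬝ᵥ j + j ⬝ᵥ k + c ⬝ᵥ c + j ⬝ᵥ c + j ⬝ᵥ i) * h2

/-- The inverse of the matrix of the metric is homogeneous and graded symmetric up to a sign. -/
theorem exists_inverse {m : ℕ} {E : Fin m → M.Vect} {e : Fin m → Z2n n} (hE : IsFrame V E e) :
    ∃ B : Matrix (Fin m) (Fin m) (M.Sections V), g.gram V E * B = 1 ∧ B * g.gram V E = 1 ∧
      (∀ I J, B I J ∈ M.homog V (e I + e J + g.deg)) ∧
      ∀ I J, B I J = (koszulSign (e I) (e I) * koszulSign (e J) (e J) * koszulSign (e J) (e I) *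
        koszulSign g.deg g.deg) • B J I := by
  obtain ⟨u, hu⟩ := g.nondegenerate V m E e hE
  set B : Matrix (Fin m) (Fin m) (M.Sections V) := (↑u⁻¹ : Matrix (Fin m) (Fin m) (M.Sections V))
    with hBdef
  have hgB : g.gram V E * B = 1 := by
    change (Matrix.of _) * B = 1
    rw [← hu, hBdef, Units.mul_inv]
  have hBg : B * g.gram V E = 1 := by
    change B * (Matrix.of _) = 1
    rw [← hu, hBdef, Units.inv_mul]
  have hmem : ∀ I J, B I J ∈ M.homog V (e I + e J + g.deg) := by
    -- Projecting the entries of `B` to their expected degrees projects `g B = 1` to degree `e I + e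
    -- K`, which preserves it. Uniqueness of inverses then gives homogeneity.
    let B' : Matrix (Fin m) (Fin m) (M.Sections V) :=
      fun I J => M.component V (e I + e J + g.deg) (B I J)
    have h1 : g.gram V E * B' = 1 := by
      ext I K
      have h2 : (g.gram V E * B') I K = M.component V (e I + e K) ((g.gram V E * B) I K) := by
        rw [Matrix.mul_apply, Matrix.mul_apply, map_sum]
        refine Finset.sum_congr rfl fun J _ => ?_
        rw [← component_mul_left _ (gram_mem_homog hE I J)]
        congr 2
        have h3 : e I + e J + g.deg + (e J + e K + g.deg) =
            e I + e K + (e J + e J) + (g.deg + g.deg) := by abel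
        rw [h3, Z2n.add_self, Z2n.add_self, add_zero, add_zero]
      rw [h2, hgB]
      by_cases h : I = K
      · subst h
        rw [Z2n.add_self, Matrix.one_apply_eq]
        exact component_of_mem one_mem_homog
      · rw [Matrix.one_apply_ne h, map_zero]
    have h2 : B = B' := left_inv_eq_right_inv hBg h1
    intro I J
    rw [h2]
    exact component_mem _ _
  refine ⟨B, hgB, hBg, hmem, ?_⟩
  -- The signed transpose is a left inverse of `g`, hence equals `B`. The factor `(-1)^⟨deg g, deg
  -- g⟩` compensates for commuting `B` past `g`, both of whose entries carry the degree of `g`.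
  let B' : Matrix (Fin m) (Fin m) (M.Sections V) := fun I J =>
    (koszulSign (e I) (e I) * koszulSign (e J) (e J) * koszulSign (e J) (e I) *
        koszulSign g.deg g.deg) • B J I
  have h1 : B' * g.gram V E = 1 := by
    ext K I
    have h2 : (B' * g.gram V E) K I = (koszulSign (e K) (e K) * koszulSign (e K) (e I) *
        koszulSign (e K) g.deg * koszulSign g.deg (e I)) • (g.gram V E * B) I K := by
      rw [Matrix.mul_apply, Matrix.mul_apply, Finset.smul_sum]
      refine Finset.sum_congr rfl fun J _ => ?_
      rw [← inverse_sign (e I) (e J) (e K) g.deg, smul_mul_assoc,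
        mul_comm_of_mem (hmem J K) (gram_mem_homog hE J I), gram_symm hE J I, smul_mul_assoc,
        smul_smul, smul_smul, mul_assoc]
    rw [h2, hgB]
    by_cases h : I = K
    · subst h
      have : koszulSign (e I) (e I) * koszulSign (e I) (e I) *
        koszulSign (e I) g.deg * koszulSign g.deg (e I) = 1 := by
        rw [koszulSign_mul_self, one_mul, koszulSign_symm, koszulSign_mul_self]
      rw [this, one_smul]
    · rw [Matrix.one_apply_ne h, Matrix.one_apply_ne (Ne.symm h), smul_zero]
  intro I J
  have h2 : B' = B := left_inv_eq_right_inv h1 hgB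
  conv_lhs => rw [← h2]

/-! ### The gradient -/

theorem exists_local_gradient {a : Z2n n} {f : M.Functions} (hf : f ∈ M.HomogFunctions a)
    (x : M.space) : ∃ (W : Opens M.space) (G : M.Vect), x ∈ W ∧ G.IsHomog (a + g.deg) ∧
      ∀ X : M.Vect, M.res W (X.app f) = koszulSign a g.deg • M.res W (g.pairing X G) := by
  obtain ⟨V, m, E, e, hxV, hE⟩ := exists_frame x
  obtain ⟨B, -, hBg, hB, -⟩ := exists_inverse (g := g) hE
  -- These components solve `E_K(f) = ± ⟨E_K | G⟩` by means of `B`. The signs come from the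
  -- convention for the gradient and from exchanging `E_I` with `G`, since linearity is on the left.
  let k : Fin m → M.Sections V := fun J => ∑ I, (koszulSign a g.deg *
    koszulSign (e I) (a + g.deg)) • (M.res V ((E I).app f) * B I J)
  have hk : ∀ J, k J ∈ M.homog V (a + g.deg + e J) := by
    intro J
    refine sum_mem fun I _ => zsmul_mem_homog _ ?_
    have h1 := mul_mem_homog (res_mem V ((hE.homog I).degree a f hf)) (hB I J)
    have h2 : e I + a + (e I + e J + g.deg) = a + g.deg + e J + (e I + e I) := by abel
    rwa [h2, Z2n.add_self, add_zero] at h1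
  obtain ⟨k', W, hW, hxW, hk', hk'deg⟩ := exists_extension_family hxV k
  have hG : (∑ J, k' J • E J : M.Vect).IsHomog (a + g.deg) := by
    have h1 : (∑ J, k' J • E J : M.Vect).1 = ∑ J, k' J • (E J).1 := by simp
    rw [Vect.IsHomog, h1]
    refine IsHomogDerivation.sum fun J => ?_
    have h2 := (hE.homog J).smul (hk'deg J _ (hk J))
    rwa [add_assoc, Z2n.add_self, add_zero] at h2
  refine ⟨W, ∑ J, k' J • E J, hxW, hG, ?_⟩
  have h1 : ∀ K, M.res W ((E K).app f) =
      koszulSign a g.deg • M.res W (g.pairing (E K) (∑ J, k' J • E J)) := by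
    intro K
    have h2 : ∑ J, k J * g.gram V E J K =
        (koszulSign a g.deg * koszulSign (e K) (a + g.deg)) • M.res V ((E K).app f) := by
      calc ∑ J, k J * g.gram V E J K
          = ∑ I, (koszulSign a g.deg * koszulSign (e I) (a + g.deg)) •
              (M.res V ((E I).app f) * (B * g.gram V E) I K) := by
            simp only [k, Finset.sum_mul, Matrix.mul_apply, Finset.mul_sum, Finset.smul_sum,
              smul_mul_assoc, mul_assoc]
            exact Finset.sum_comm
        _ = _ := by
            rw [hBg, Finset.sum_eq_single K]
            · rw [Matrix.one_apply_eq, mul_one]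
            · intro I _ hI
              rw [Matrix.one_apply_ne hI, mul_zero, smul_zero]
            · simp
    rw [g.symm _ _ _ _ (hE.homog K) hG, sum_left, map_zsmul, map_sum]
    have h3 : ∑ J, M.res W (g.pairing (k' J • E J) (E K)) =
        M.restrict hW (∑ J, k J * g.gram V E J K) := by
      rw [map_sum]
      refine Finset.sum_congr rfl fun J _ => ?_
      rw [g.smul_left, map_mul, map_mul, hk', gram_apply, restrict_res]
    rw [h3, h2, map_zsmul, restrict_res, smul_smul, smul_smul]
    have h4 : koszulSign a g.deg * koszulSign (e K) (a + g.deg) *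
        (koszulSign a g.deg * koszulSign (e K) (a + g.deg)) = 1 := by
      rw [mul_mul_mul_comm, koszulSign_mul_self, koszulSign_mul_self, one_mul]
    rw [h4, one_smul]
  intro X
  obtain ⟨c, hc⟩ := hE.exists_components fun _ : Fin 1 => X
  have hcW : ∀ h, M.res W (X.app h) = ∑ J, M.restrict hW (c 0 J) * M.res W ((E J).app h) := by
    intro h
    rw [← restrict_res hW, hc 0 h, map_sum]
    exact Finset.sum_congr rfl fun J _ => by rw [map_mul, restrict_res]
  rw [hcW, res_pairing_eq_sum hcW, Finset.smul_sum]
  exact Finset.sum_congr rfl fun J _ => by rw [h1, mul_smul_comm]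

/-- Non-degeneracy makes local gradients agree on overlaps. For each `h` the functions `G_x(h)` then
glue, and the derivation and gradient properties are checked locally. -/
theorem exists_gradient {a : Z2n n} {f : M.Functions} (hf : f ∈ M.HomogFunctions a) :
    ∃ G : M.Vect, G.IsHomog (a + g.deg) ∧ g.IsGradient a f G := by
  choose W G hxW hG hgrad using fun x => exists_local_gradient (g := g) hf x
  have hcompat : ∀ x y h, M.res (W x ⊓ W y) ((G x).app h) = M.res (W x ⊓ W y) ((G y).app h) := by
    intro x y h
    have h1 : (G x - G y).VanishesOn (W x ⊓ W y) := by
      refine vanishesOn_of_pairing_eq_zero (g := g) ((hG x).sub (hG y)) fun X => ?_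
      have h2 := congrArg (M.restrict (inf_le_left : W x ⊓ W y ≤ W x)) (hgrad x X)
      have h3 := congrArg (M.restrict (inf_le_right : W x ⊓ W y ≤ W y)) (hgrad y X)
      rw [map_zsmul, restrict_res, restrict_res] at h2 h3
      rw [h2] at h3
      have h4 := congrArg (koszulSign a g.deg • ·) h3
      simp only [koszulSign_smul_smul] at h4
      rw [sub_right, map_sub, h4, sub_self]
    have h2 := h1 h
    rwa [Vect.app_sub, map_sub, sub_eq_zero] at h2
  have hglue : ∀ h : M.Functions, ∃ k : M.Functions,
      ∀ x, M.res (W x) k = M.res (W x) ((G x).app h) := fun h =>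
    M.exists_glue W (fun x => ⟨x, hxW x⟩) _ fun x y => by
      rw [restrict_res, restrict_res]; exact hcompat x y h
  choose T hT using hglue
  have hext : ∀ {k k' : M.Functions}, (∀ x, M.res (W x) k = M.res (W x) k') → k = k' := fun h =>
    function_ext fun x => ⟨W x, hxW x, h x⟩
  let D : M.Functions →ₗ[ℝ] M.Functions :=
    { toFun := T
      map_add' := fun h k => hext fun x => by
        rw [map_add, hT, hT, hT, ← map_add]; exact congrArg _ (map_add (G x).1 h k)
      map_smul' := fun r h => hext fun x => by
        rw [RingHom.id_apply, map_smul, hT, hT, ← map_smul]; exact congrArg _ (map_smul (G x).1 r h) }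
  have hD : ∀ h x, M.res (W x) (D h) = M.res (W x) ((G x).app h) := hT
  have hDer : M.IsHomogDerivation (a + g.deg) D := by
    refine ⟨fun b h hh => ?_, fun b h hh k => hext fun x => ?_⟩
    · refine function_mem_homog_of_locally fun x => ⟨W x, hxW x, ?_⟩
      rw [hD]
      exact res_mem _ ((hG x).degree b h hh)
    · have h1 := congrArg (M.res (W x)) ((hG x).leibniz b h hh k)
      rw [map_add, map_zsmul, map_mul (M.res (W x)), map_mul (M.res (W x))] at h1
      rw [map_add, map_zsmul, map_mul (M.res (W x)), map_mul (M.res (W x)), hD, hD, hD]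
      exact h1
  refine ⟨⟨D, hDer.mem_vect⟩, hDer, fun X => hext fun x => ?_⟩
  have h1 : Vect.VanishesOn ((⟨D, hDer.mem_vect⟩ : M.Vect) - G x) (W x) := fun h => by
    rw [Vect.app_sub, map_sub, sub_eq_zero]
    exact hD h x
  have h2 := res_pairing_right_eq_zero (g := g)
    (Y := (⟨D, hDer.mem_vect⟩ : M.Vect) - G x) (IsHomogDerivation.sub hDer (hG x)) h1 X
  rw [sub_right, map_sub, sub_eq_zero] at h2
  rw [map_zsmul, h2]
  exact hgrad x X

/-- Being a gradient does not include homogeneity; it is inherited from the constructed gradient by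
uniqueness. -/
theorem IsGradient.isHomog {a : Z2n n} {f : M.Functions} (hf : f ∈ M.HomogFunctions a)
    {G : M.Vect} (hG : g.IsGradient a f G) : G.IsHomog (a + g.deg) := by
  obtain ⟨G', hG', hgrad⟩ := exists_gradient (g := g) hf
  have : G - G' = 0 := eq_zero_of_pairing_eq_zero (g := g) fun X => by
    have h1 := congrArg (koszulSign a g.deg • ·) ((hG X).symm.trans (hgrad X))
    simp only [koszulSign_smul_smul] at h1
    rw [sub_right, h1, sub_self]
  have hGG' : G = G' := sub_eq_zero.1 this
  rw [hGG']
  exact hG'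

/-! ### The divergence of a gradient -/

section Divergence

variable {D : AffineConnection M} {a : Z2n n} {f : M.Functions} {G : M.Vect}

/-- The Hessian `X(Y(f)) - (∇_X Y)(f)`. -/
def hessian (D : AffineConnection M) (f : M.Functions) (X Y : M.Vect) : M.Functions :=
  X.app (Y.app f) - (D.nabla X Y).app f

/-- The graded antisymmetrization of the Hessian is minus the torsion applied to `f`. -/
theorem hessian_symm (hD : D.IsSymmetric) {x y : Z2n n} {X Y : M.Vect} (hX : X.IsHomog x)
    (hY : Y.IsHomog y) : hessian D f X Y = koszulSign x y • hessian D f Y X := by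
  have h := LinearMap.congr_fun (hD x y X Y hX hY) f
  have h1 : (D.nabla X Y).app f - koszulSign x y • (D.nabla Y X).app f -
      (X.app (Y.app f) - koszulSign x y • Y.app (X.app f)) = 0 := h
  rw [hessian, hessian, smul_sub]
  rw [← sub_eq_zero, ← neg_eq_zero, ← h1]
  abel

/-- Differentiate `⟨G | Y⟩ = ± Y(f)` along `X`. In the metric rule the term `⟨G | ∇_X Y⟩` is again a
derivative of `f`, and what remains is the Hessian. -/
theorem pairing_nabla_gradient (hD : D.IsMetricCompatible g) (hG : G.IsHomog (a + g.deg))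
    (hgrad : g.IsGradient a f G) {x y : Z2n n} {X Y : M.Vect} (hX : X.IsHomog x)
    (hY : Y.IsHomog y) : g.pairing (D.nabla X G) Y =
      (koszulSign a g.deg * koszulSign (a + g.deg) y) • hessian D f X Y := by
  have hpair : ∀ {z : Z2n n} {Z : M.Vect}, Z.IsHomog z → g.pairing G Z =
      (koszulSign a g.deg * koszulSign (a + g.deg) z) • Z.app f := by
    intro z Z hZ
    rw [hgrad Z, smul_smul, g.symm _ _ _ _ hG hZ, mul_right_comm, koszulSign_mul_self, one_mul]
  have h1 := hD x (a + g.deg) X G Y hX hG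
  rw [hpair hY, hpair (D.homog _ _ _ _ hX hY), smul_smul] at h1
  have h2 : koszulSign x (a + g.deg) *
      (koszulSign a g.deg * koszulSign (a + g.deg) (x + y)) =
      koszulSign a g.deg * koszulSign (a + g.deg) y := by
    rw [koszulSign_add_right (a + g.deg) x y, koszulSign_symm x]
    linear_combination (koszulSign a g.deg * koszulSign (a + g.deg) y) *
      koszulSign_mul_self (a + g.deg) x
  have h3 : X.app ((koszulSign a g.deg * koszulSign (a + g.deg) y) • Y.app f) =
      (koszulSign a g.deg * koszulSign (a + g.deg) y) • X.app (Y.app f) := map_zsmul X.1 _ _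
  rw [h2, h3] at h1
  rw [hessian, smul_sub, h1, add_sub_cancel_right]

/-- When `I` and `K` are exchanged in the trace, the Hessian and `B` contribute their symmetry
signs. Modulo two everything cancels against the trace signs except `⟨c, c⟩`, with `c` the degree of
the metric. -/
theorem divergence_sign (i k a c : Z2n n) :
    koszulSign k (k + (a + c)) * (koszulSign a c * koszulSign (a + c) i) * koszulSign k i *
      (koszulSign i i * koszulSign k k * koszulSign k i * koszulSign c c) =
    koszulSign c c * (koszulSign i (i + (a + c)) * (koszulSign a c * koszulSign (a + c) k)) := by
  simp only [koszulSign, ← paritySign_add, add_dotProduct, dotProduct_add]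
  congr 1
  rw [dotProduct_comm k a, dotProduct_comm k c, dotProduct_comm i a, dotProduct_comm i c]
  have h2 : (2 : ZMod 2) = 0 := rfl
  linear_combination (k ⬝ᵥ k + k ⬝ᵥ i) * h2

theorem isDivergence_gradient_zero (hg : IsOddDegree g.deg) (hD : D.IsLeviCivita g)
    (hG : G.IsHomog (a + g.deg)) (hgrad : g.IsGradient a f G) :
    D.IsDivergence (a + g.deg) G 0 := by
  intro V m E e hE c hc
  obtain ⟨B, hgB, -, -, hBsymm⟩ := exists_inverse (g := g) hE
  have hcB : ∀ I, c I I = ∑ K, (koszulSign a g.deg * koszulSign (a + g.deg) (e K)) •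
      (M.res V (hessian D f (E I) (E K)) * B K I) := by
    intro I
    calc c I I = ∑ L, c I L * (g.gram V E * B) L I := by simp [hgB, Matrix.one_apply]
      _ = ∑ K, (∑ L, c I L * g.gram V E L K) * B K I := by
        simp only [Matrix.mul_apply, Finset.mul_sum, Finset.sum_mul, mul_assoc]
        exact Finset.sum_comm
      _ = _ := Finset.sum_congr rfl fun K _ => by
        have h1 := res_pairing_eq_sum (g := g) (hc I) (E K)
        change M.res V (g.pairing (D.nabla (E I) G) (E K)) = ∑ J, c I J * g.gram V E J K at h1
        rw [← h1, pairing_nabla_gradient hD.metricCompatible hG hgrad (hE.homog I) (hE.homog K),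
          map_zsmul, smul_mul_assoc]
  -- The full trace term, signs included, is antisymmetric in `I` and `K`. This covers the diagonal
  -- too, where a term equals its own negative.
  let T : Fin m → Fin m → M.Sections V := fun I K =>
    (koszulSign (e I) (e I + (a + g.deg)) *
      (koszulSign a g.deg * koszulSign (a + g.deg) (e K))) •
      (M.res V (hessian D f (E I) (E K)) * B K I)
  have hT : ∀ I K, T K I = - T I K := by
    intro I K
    simp only [T]
    rw [hessian_symm hD.symmetric (hE.homog K) (hE.homog I), hBsymm I K, map_zsmul,
      smul_mul_assoc, mul_smul_comm, smul_smul, smul_smul, divergence_sign,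
      koszulSign_self_of_isOddDegree hg, neg_one_mul, neg_smul]
  have hsum : ∑ I, koszulSign (e I) (e I + (a + g.deg)) • c I I = ∑ I, ∑ K, T I K := by
    refine Finset.sum_congr rfl fun I _ => ?_
    rw [hcB, Finset.smul_sum]
    exact Finset.sum_congr rfl fun K _ => smul_smul _ _ _
  have hneg : ∑ I, ∑ K, T I K = - ∑ I, ∑ K, T I K := by
    conv_lhs => rw [Finset.sum_comm]
    simp only [← Finset.sum_neg_distrib]
    exact Finset.sum_congr rfl fun K _ => Finset.sum_congr rfl fun I _ => hT K I
  rw [hsum, map_zero]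
  -- Sections form a real vector space, so a section equal to its negative is zero.
  have h2 : (2 : ℝ) • ∑ I, ∑ K, T I K = 0 := by
    rw [two_smul]
    nth_rewrite 1 [hneg]
    exact neg_add_cancel _
  exact ((smul_eq_zero.1 h2).resolve_left two_ne_zero).symm

end Divergence

end RiemannianMetric

end Z2nManifold

/-! ### The connection Laplacian of an odd metric -/

open Z2nManifold Z2nRingedSpace RiemannianMetric in
theorem theorem2 {n : ℕ} (M : Z2nManifold.{u} n) (g : Z2nManifold.RiemannianMetric M)
    (hg : IsOddDegree g.deg) (D : Z2nManifold.AffineConnection M) (hD : D.IsLeviCivita g)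
    (Δ : M.Functions →ₗ[ℝ] M.Functions) :
    g.IsConnectionLaplacian D Δ ↔ Δ = 0 := by
  constructor
  · intro h
    have hhom : ∀ a, ∀ f ∈ M.HomogFunctions a, Δ f = 0 := by
      intro a f hf
      obtain ⟨G, hgrad, hdiv⟩ := h a f hf
      have hzero := isDivergence_gradient_zero hg hD (hgrad.isHomog hf) hgrad
      refine function_ext fun x => ?_
      -- Both `Δ f` and `0` are divergences of `G`. A frame around `x` evaluates both by the same
      -- trace, so they agree near `x`.
      obtain ⟨V, m, E, e, hxV, hE⟩ := exists_frame x
      obtain ⟨c, hc⟩ := hE.exists_components fun I => D.derivativeOf G (E I)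
      exact ⟨V, hxV, (hdiv V m E e hE c hc).trans (hzero V m E e hE c hc).symm⟩
    ext f
    rw [← sum_component f, map_sum]
    exact Finset.sum_eq_zero fun a _ => hhom a _ (component_mem a f)
  -- The converse is not vacuous: a gradient must exist for every homogeneous `f`.
  · rintro rfl a f hf
    obtain ⟨G, hG, hgrad⟩ := exists_gradient (g := g) hf
    exact ⟨G, hgrad, isDivergence_gradient_zero hg hD hG hgrad⟩
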